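/- Let $M$ be a smooth $5$-manifold with a volume form $\Omega$, let $B$ be a smooth $2$-manifold with an area form $\omega$, and let $\pi:M\to B$ be a surjective submersion with vertical bundle $\mathbb V=\ker d\pi$ and annihilator $\mathbb V^\circ\subset T^*M$. Let $(\gamma,\kappa,\beta)$ be a triple consisting of an Ehresmann connection $\gamma:TM\to\mathbb V$ (a smooth bundle map with $\gamma|_{\mathbb V}=\mathrm{id}$) with horizontal bundle $\mathbb H=\ker\gamma$, a function $\kappa\in C^\infty(M)$ and a smooth $1$-form $\beta$ vanishing on $\mathbb H$. For a bivector field $Q$ write $Q^\sharp\alpha=\mathbf i_\alpha Q=Q(\alpha,\cdot)$, and let $Q_{2,0}\in\Gamma\wedge^2\mathbb H$ and $Q_{0,2}\in\Gamma\wedge^2\mathbb V$ be its horizontal and vertical components with respect to $TM=\mathbb H\oplus\mathbb V$. Put $\mathbf i_{X\wedge Y}=\mathbf i_X\circ\mathbf i_Y$ for the interior product of forms with multivectors. Let $\psi$ be the bivector field on $B$ with $\mathbf i_\psi\omega=-1$, $\mathrm{hor}^\gamma$ the horizontal lift, $\Omega^{\mathrm V}$ the unique $3$-form that vanishes when an argument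 is horizontal and satisfies $\Omega=\pi^*\omega\wedge\Omega^{\mathrm V}$, $\mathrm Q_{\mathrm V}\in\Gamma\wedge^3\mathbb V$ the vertical $3$-vector field with $\mathbf i_{\mathrm Q_{\mathrm V}}\Omega^{\mathrm V}=1$, and $P_\beta:=-\mathbf i_\beta\mathrm Q_{\mathrm V}$. Assume that $$\Pi=\kappa\,\mathrm{hor}^\gamma\psi+P_\beta$$ is a Poisson tensor, i.e. its Schouten bracket with itself vanishes. Let $\mathcal Z(\kappa)$ be the zero set of $\kappa$ and $M^\Pi=\{p\in M:\operatorname{rank}_p\Pi_{2,0}=2\}$. Then: (i) $M^\Pi=M\setminus\mathcal Z(\kappa)$, and this set is open. On $M^\Pi$, $\Pi$ is a coupling Poisson tensor with geometric data $(\gamma,\sigma,P_\beta)$, where $\sigma=\frac1\kappa\pi^*\omega$; that is, $\Pi$ is Poisson, $\mathbb H=\Pi^\sharp(\mathbb V^\circ)$, the form $\sigma\in\Gamma\wedge^2\mathbb V^\circ$ satisfies $\mathbf i_{\mathbf i_\alpha\Pi_{2,0}}\sigma=-\alpha$ for all $\alpha\in\mathbb V^\circ$, and $\Pi_{0,2}=P_\beta$.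 On $M^\Pi$, $\gamma$ is a Poisson connection, i.e. $L_{\mathrm{hor}^\gamma u}P_\beta=0$ for every vector field $u$ on $B$, and it is the unique Ehresmann connection over $M^\Pi$ whose horizontal bundle contains (equivalently, equals) $\Pi^\sharp(\mathbb V^\circ)$. (ii) $P_\beta$ is a vertical Poisson tensor, and $\Pi=P_\beta$ on the interior of $\mathcal Z(\kappa)$. (iii) $(d_{0,1}\kappa)_p\wedge\beta_p=0$ at every point $p$ of the boundary of $\mathcal Z(\kappa)$, where $d_{0,1}\kappa=d\kappa\circ\gamma$. -/

import Mathlib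

open Set Module
open scoped Manifold ContDiff

namespace AlmostCoupling

/-! ## Linear algebra of multivectors and forms on a real vector space -/

section LinearAlgebra

variable {T S : Type*} [AddCommGroup T] [Module ℝ T] [AddCommGroup S] [Module ℝ S]

/-- Exterior `k`-forms on `T`, with the determinant convention
`(a₁ ∧ ⋯ ∧ aₖ)(v₁, …, vₖ) = det (aⱼ(vᵢ))`. -/
abbrev Form (T : Type*) [AddCommGroup T] [Module ℝ T] (k : ℕ) : Type _ :=
  T [⋀^Fin k]→ₗ[ℝ] ℝ

/-- `k`-vectors on the (finite dimensional) space `T`, seen as alternating functions of `k`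
covectors, `(v₁ ∧ ⋯ ∧ vₖ)(a₁, …, aₖ) = det (aᵢ(vⱼ))`. -/
abbrev MultiVec (T : Type*) [AddCommGroup T] [Module ℝ T] (k : ℕ) : Type _ :=
  Dual ℝ T [⋀^Fin k]→ₗ[ℝ] ℝ

/-- The decomposable `k`-form `a₁ ∧ ⋯ ∧ aₖ`. -/
noncomputable def covWedge {k : ℕ} (a : Fin k → Dual ℝ T) : Form T k :=
  (Matrix.detRowAlternating (n := Fin k) (R := ℝ)).compLinearMap (LinearMap.pi a)

/-- The decomposable `k`-vector `v₁ ∧ ⋯ ∧ vₖ`. -/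
noncomputable def vecWedge {k : ℕ} (v : Fin k → T) : MultiVec T k :=
  (Matrix.detRowAlternating (n := Fin k) (R := ℝ)).compLinearMap
    (LinearMap.pi fun j => Dual.eval ℝ T (v j))

theorem covWedge_apply {k : ℕ} (a : Fin k → Dual ℝ T) (v : Fin k → T) :
    covWedge a v = (Matrix.of fun i j => a j (v i)).det := rfl

theorem vecWedge_apply {k : ℕ} (v : Fin k → T) (a : Fin k → Dual ℝ T) :
    vecWedge v a = (Matrix.of fun i j => a i (v j)).det := rfl

/-- `i_α Q = Q(α, ·, …, ·)` for a covector `α` and a multivector `Q`. -/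
noncomputable def contractCov {k : ℕ} (α : Dual ℝ T) (Q : MultiVec T (k + 1)) : MultiVec T k :=
  Q.curryLeft α

/-- `i_v η = η(v, ·, …, ·)` for a vector `v` and a form `η`. -/
noncomputable def contractVec {k : ℕ} (v : T) (η : Form T (k + 1)) : Form T k :=
  η.curryLeft v

/-- The map `α ↦ Q(α, ·)` from covectors to the bidual. -/
noncomputable def sharpBidual (Q : MultiVec T 2) : Dual ℝ T →ₗ[ℝ] Dual ℝ (Dual ℝ T) :=
  LinearMap.mk₂ ℝ (fun α β => Q ![α, β])
    (fun a b c => Q.map_vecCons_add ![c] a b)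
    (fun r a c => Q.map_vecCons_smul ![c] r a)
    (fun a b c => (Q.curryLeft a).map_vecCons_add ![] b c)
    (fun r a c => (Q.curryLeft a).map_vecCons_smul ![] r c)

/-- `Q^♯ : T* → T`, `α ↦ i_α Q`, that is, `β (Q^♯ α) = Q(α, β)` for all `β`. -/
noncomputable def sharp [FiniteDimensional ℝ T] (Q : MultiVec T 2) : Dual ℝ T →ₗ[ℝ] T :=
  (evalEquiv ℝ T).symm.toLinearMap ∘ₗ sharpBidual Q

theorem apply_sharp [FiniteDimensional ℝ T] (Q : MultiVec T 2) (α β : Dual ℝ T) :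
    β (sharp Q α) = Q ![α, β] := by
  have h : evalEquiv ℝ T (sharp Q α) = sharpBidual Q α := by simp [sharp]
  exact congrArg (fun l => l β) h

/-- Push-forward of multivectors along a linear map. -/
noncomputable def pushMultiVec {k : ℕ} (h : S →ₗ[ℝ] T) (Q : MultiVec S k) : MultiVec T k :=
  Q.compLinearMap h.dualMap

/-- A multivector lies in `⋀ᵏ W`, for a subspace `W`, when it vanishes as soon as one of its
arguments annihilates `W`. -/
def MultiVec.LiesIn {k : ℕ} (Q : MultiVec T k) (W : Submodule ℝ T) : Prop :=
  ∀ a : Fin k → Dual ℝ T, (∃ i, a i ∈ W.dualAnnihilator) → Q a = 0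

/-- A form lies in `⋀ᵏ W°`, for a subspace `W`, when it vanishes as soon as one of its
arguments belongs to `W`. -/
def Form.LiesInAnn {k : ℕ} (η : Form T k) (W : Submodule ℝ T) : Prop :=
  ∀ v : Fin k → T, (∃ i, v i ∈ W) → η v = 0

end LinearAlgebra

/-! ## Tensor fields on manifolds -/

section Fields

variable {n : ℕ} {M : Type*} [TopologicalSpace M] [ChartedSpace (EuclideanSpace ℝ (Fin n)) M]

instance instFiniteDimensionalTangentSpace (p : M) :
    FiniteDimensional ℝ (TangentSpace (𝓡 n) p) :=
  inferInstanceAs (FiniteDimensional ℝ (EuclideanSpace ℝ (Fin n)))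

/-- The tangent space of `M` at `p`. -/
abbrev Tan (n : ℕ) {M : Type*} [TopologicalSpace M]
    [ChartedSpace (EuclideanSpace ℝ (Fin n)) M] (p : M) : Type :=
  TangentSpace (𝓡 n) p

/-- The basis of the tangent space at `p` given by the preferred chart at `p`. -/
noncomputable def tanFrame (p : M) : Fin n → Tan n p :=
  fun i => (EuclideanSpace.basisFun (Fin n) ℝ i : EuclideanSpace ℝ (Fin n))

/-- The differential of a function, as a covector at `p`. -/
noncomputable def dAt (f : M → ℝ) (p : M) : Dual ℝ (Tan n p) :=
  (mvfderiv (𝓡 n) f p : Tan n p →L[ℝ] ℝ).toLinearMap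

/-- Smoothness of a function on a set. -/
def SmoothFunOn (n : ℕ) {M : Type*} [TopologicalSpace M]
    [ChartedSpace (EuclideanSpace ℝ (Fin n)) M] (f : M → ℝ) (U : Set M) : Prop :=
  ContMDiffOn (𝓡 n) 𝓘(ℝ, ℝ) ∞ f U

/-- Smoothness of a vector field on a set. -/
def SmoothVecOn [IsManifold (𝓡 n) ∞ M] (X : ∀ p : M, Tan n p) (U : Set M) : Prop :=
  ContMDiffOn (𝓡 n) (𝓡 n).tangent ∞ (fun p => (⟨p, X p⟩ : TangentBundle (𝓡 n) M)) U

/-- A `k`-form on the open set `U` is smooth when its values on smooth local vector fields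
are smooth functions. -/
def SmoothFormOn [IsManifold (𝓡 n) ∞ M] {k : ℕ} (η : ∀ p : M, Form (Tan n p) k) (U : Set M) : Prop :=
  ∀ V : Set M, IsOpen V → V ⊆ U → ∀ X : Fin k → ∀ p : M, Tan n p,
    (∀ i, SmoothVecOn (X i) V) → SmoothFunOn n (fun p => η p fun i => X i p) V

/-- A `k`-vector field on the open set `U` is smooth when its values on differentials of smooth
local functions (which locally generate all 1-forms) are smooth functions. -/
def SmoothMultiVecOn {k : ℕ} (Q : ∀ p : M, MultiVec (Tan n p) k) (U : Set M) : Prop :=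
  ∀ V : Set M, IsOpen V → V ⊆ U → ∀ f : Fin k → M → ℝ,
    (∀ i, SmoothFunOn n (f i) V) → SmoothFunOn n (fun p => Q p fun i => dAt (f i) p) V

/-- The function `P(df, dg)`. -/
noncomputable def bracket (P : ∀ p : M, MultiVec (Tan n p) 2) (f g : M → ℝ) : M → ℝ :=
  fun p => P p ![dAt f p, dAt g p]

/-- The Schouten bracket `⟦P, Q⟧` of two bivector fields, evaluated at `p` on the exact 1-forms
`df, dg, dh`:
`⟦P, Q⟧(df, dg, dh) = ∑_cyc (P(d(Q(df, dg)), dh) + Q(d(P(df, dg)), dh))`,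
up to an overall sign, which depends on the author. -/
noncomputable def schouten (P Q : ∀ p : M, MultiVec (Tan n p) 2) (f g h : M → ℝ) (p : M) : ℝ :=
  (bracket P (bracket Q f g) h p + bracket Q (bracket P f g) h p) +
  (bracket P (bracket Q g h) f p + bracket Q (bracket P g h) f p) +
  (bracket P (bracket Q h f) g p + bracket Q (bracket P h f) g p)

/-- `P` is a Poisson tensor on the open set `U`: a smooth bivector field with `⟦P, P⟧ = 0`. A
trivector vanishes when it vanishes on all triples of differentials of local functions. -/
def IsPoissonOn (P : ∀ p : M, MultiVec (Tan n p) 2) (U : Set M) : Prop :=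
  SmoothMultiVecOn P U ∧
  ∀ V : Set M, IsOpen V → V ⊆ U → ∀ f g h : M → ℝ,
    SmoothFunOn n f V → SmoothFunOn n g V → SmoothFunOn n h V →
    ∀ p ∈ V, schouten P P f g h p = 0

/-- The Lie derivative of the bivector field `P` along the vector field `X`, evaluated at `p` on
`df, dg`: `(L_X P)(df, dg) = X(P(df, dg)) - P(d(X f), dg) - P(df, d(X g))`. -/
noncomputable def lieDeriv (X : ∀ p : M, Tan n p) (P : ∀ p : M, MultiVec (Tan n p) 2)
    (f g : M → ℝ) (p : M) : ℝ :=
  dAt (bracket P f g) p (X p) - bracket P (fun q => dAt f q (X q)) g p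
    - bracket P f (fun q => dAt g q (X q)) p

end Fields

/-! ## Fibered manifolds, Ehresmann connections, coupling tensors -/

section Fibered

variable {m n : ℕ} {M B : Type*}
  [TopologicalSpace M] [ChartedSpace (EuclideanSpace ℝ (Fin m)) M]
  [TopologicalSpace B] [ChartedSpace (EuclideanSpace ℝ (Fin n)) B]

/-- The differential of `π` at `p`. -/
noncomputable def dProj (π : M → B) (p : M) : Tan m p →L[ℝ] Tan n (π p) :=
  mfderiv (𝓡 m) (𝓡 n) π p

/-- The vertical subspace `𝕍_p = ker d_pπ`. -/
noncomputable def vert (π : M → B) (p : M) : Submodule ℝ (Tan m p) :=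
  LinearMap.ker (dProj (m := m) (n := n) π p).toLinearMap

/-- The pull-back `π^* η` of a form on the base. -/
noncomputable def pullForm {k : ℕ} (π : M → B) (η : ∀ b : B, Form (Tan n b) k) (p : M) :
    Form (Tan m p) k :=
  (η (π p)).compLinearMap (dProj (m := m) (n := n) π p).toLinearMap

/-- `γ` is (the connection form of) an Ehresmann connection over the open set `U`: a smooth
endomorphism of the tangent bundle with values in `𝕍` and restricting to the identity of `𝕍`. -/
structure IsEhresmannOn [IsManifold (𝓡 m) ∞ M] (π : M → B) (γ : ∀ p : M, Tan m p →ₗ[ℝ] Tan m p) (U : Set M) :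
    Prop where
  mem_vert : ∀ p ∈ U, ∀ v, γ p v ∈ vert (m := m) (n := n) π p
  eq_self : ∀ p ∈ U, ∀ v ∈ vert (m := m) (n := n) π p, γ p v = v
  smooth : ∀ V : Set M, IsOpen V → V ⊆ U → ∀ X : ∀ p : M, Tan m p,
    SmoothVecOn X V → SmoothVecOn (fun p => γ p (X p)) V

/-- The horizontal subspace `ℍ_p = ker γ_p`. -/
noncomputable def hor (γ : ∀ p : M, Tan m p →ₗ[ℝ] Tan m p) (p : M) : Submodule ℝ (Tan m p) :=
  LinearMap.ker (γ p)

/-- The horizontal lift of tangent vectors at `π p`: the inverse of `d_pπ : ℍ_p → T_{π p} B`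
(an isomorphism for an Ehresmann connection on a submersion). -/
noncomputable def horLift (π : M → B) (γ : ∀ p : M, Tan m p →ₗ[ℝ] Tan m p) (p : M) :
    Tan n (π p) →ₗ[ℝ] Tan m p :=
  (hor γ p).subtype ∘ₗ
    (ContinuousLinearMap.inverse
      (dProj (m := m) (n := n) π p ∘L (hor γ p).subtypeL)).toLinearMap

/-- The component of bidegree `(2,0)` of a bivector field. -/
noncomputable def comp20 (γ : ∀ p : M, Tan m p →ₗ[ℝ] Tan m p)
    (Q : ∀ p : M, MultiVec (Tan m p) 2) (p : M) : MultiVec (Tan m p) 2 :=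
  pushMultiVec (LinearMap.id - γ p) (Q p)

/-- The component of bidegree `(0,2)` of a bivector field. -/
noncomputable def comp02 (γ : ∀ p : M, Tan m p →ₗ[ℝ] Tan m p)
    (Q : ∀ p : M, MultiVec (Tan m p) 2) (p : M) : MultiVec (Tan m p) 2 :=
  pushMultiVec (γ p) (Q p)

/-- The subspace `Q^♯(𝕍_p°)`. -/
noncomputable def sharpAnnVert (π : M → B) (Q : ∀ p : M, MultiVec (Tan m p) 2) (p : M) :
    Submodule ℝ (Tan m p) :=
  (vert (m := m) (n := n) π p).dualAnnihilator.map (sharp (Q p))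

/-- The coupling domain: the points where the horizontal part of the bivector field has rank
`n = dim B`. It does not depend on the auxiliary connection `γ`. -/
noncomputable def couplingDomain (n : ℕ) (γ : ∀ p : M, Tan m p →ₗ[ℝ] Tan m p)
    (Q : ∀ p : M, MultiVec (Tan m p) 2) : Set M :=
  {p | finrank ℝ (LinearMap.range (sharp (comp20 γ Q p))) = n}

/-- On the open set `U`, `Q` is a coupling bivector field with geometric data `(γ, σ, P)`:
`γ` is an Ehresmann connection whose horizontal subbundle is `Q^♯(𝕍°)`, the coupling form
`σ` is a smooth section of `⋀² 𝕍°` with `i_{i_α Q_{2,0}} σ = -α` for `α ∈ 𝕍°`, and `P` is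
the vertical component of `Q`. -/
structure IsCouplingWithDataOn [IsManifold (𝓡 m) ∞ M] (π : M → B) (Q : ∀ p : M, MultiVec (Tan m p) 2)
    (γ : ∀ p : M, Tan m p →ₗ[ℝ] Tan m p) (σ : ∀ p : M, Form (Tan m p) 2)
    (P : ∀ p : M, MultiVec (Tan m p) 2) (U : Set M) : Prop where
  smooth : SmoothMultiVecOn Q U
  ehresmann : IsEhresmannOn (m := m) (n := n) π γ U
  hor_eq : ∀ p ∈ U, hor γ p = sharpAnnVert (m := m) (n := n) π Q p
  smooth_form : SmoothFormOn σ U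
  form_horizontal : ∀ p ∈ U, (σ p).LiesInAnn (vert (m := m) (n := n) π p)
  form_eq : ∀ p ∈ U, ∀ α ∈ (vert (m := m) (n := n) π p).dualAnnihilator,
    ∀ v : Tan m p, contractVec (sharp (comp20 γ Q p) α) (σ p) ![v] = -α v
  vert_eq : ∀ p ∈ U, P p = comp02 γ Q p

/-- Over the open set `U`, `γ` is a Poisson connection for the vertical bivector field `P`:
`L_{hor u} P = 0` for all (local) smooth vector fields `u` on the base. -/
def IsPoissonConnectionOn [IsManifold (𝓡 n) ∞ B] (π : M → B) (γ : ∀ p : M, Tan m p →ₗ[ℝ] Tan m p)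
    (P : ∀ p : M, MultiVec (Tan m p) 2) (U : Set M) : Prop :=
  ∀ (W : Set B) (u : ∀ b : B, Tan n b), IsOpen W → SmoothVecOn u W →
    ∀ V : Set M, IsOpen V → V ⊆ U ∩ π ⁻¹' W → ∀ f g : M → ℝ,
      SmoothFunOn m f V → SmoothFunOn m g V →
      ∀ p ∈ V, lieDeriv (fun q => horLift π γ q (u (π q))) P f g p = 0

/-- The component `d_{0,1} κ = dκ ∘ γ` of bidegree `(0,1)` of `dκ`. -/
noncomputable def d01 (γ : ∀ p : M, Tan m p →ₗ[ℝ] Tan m p) (κ : M → ℝ) (p : M) :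
    Dual ℝ (Tan m p) :=
  dAt κ p ∘ₗ γ p

end Fibered

/-! ## Fibered 5-manifolds over surfaces -/

section TwoThree

variable {M B : Type*}
  [TopologicalSpace M] [ChartedSpace (EuclideanSpace ℝ (Fin 5)) M]
  [TopologicalSpace B] [ChartedSpace (EuclideanSpace ℝ (Fin 2)) B]

/-- The nondegenerate bivector field `ψ` on the surface with `i_ψ ωB = -1`, where
`i_{X ∧ Y} = i_X ∘ i_Y`. -/
noncomputable def baseBivector (ωB : ∀ b : B, Form (Tan 2 b) 2) (b : B) : MultiVec (Tan 2 b) 2 :=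
  (ωB b (tanFrame b))⁻¹ • vecWedge (tanFrame b)

/-- The 3-form `Ω^V` of bidegree `(0,3)` with `Ω = π^*ωB ∧ Ω^V`: with the frame `u₁, u₂` of
`T_{π p} B`, it is
`Ω^V(w₁, w₂, w₃) = Ω(hor u₁, hor u₂, γ w₁, γ w₂, γ w₃) / ωB(u₁, u₂)`. -/
noncomputable def vertVolume (π : M → B) (Ω : ∀ p : M, Form (Tan 5 p) 5)
    (ωB : ∀ b : B, Form (Tan 2 b) 2) (γ : ∀ p : M, Tan 5 p →ₗ[ℝ] Tan 5 p) (p : M) :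
    Form (Tan 5 p) 3 :=
  (ωB (π p) (tanFrame (π p)))⁻¹ •
    (contractVec (horLift (n := 2) π γ p (tanFrame (π p) 1))
      (contractVec (horLift (n := 2) π γ p (tanFrame (π p) 0)) (Ω p))).compLinearMap (γ p)

/-- Some basis of the vertical space at `p`. -/
noncomputable def vertFrame (π : M → B) (p : M) : Fin 3 → Tan 5 p :=
  Classical.epsilon fun v : Fin 3 → Tan 5 p =>
    LinearIndependent ℝ v ∧ Submodule.span ℝ (range v) = vert (m := 5) (n := 2) π p

/-- The vertical 3-vector field `Q_V` with `i_{Q_V} Ω^V = 1`, where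
`i_{v₁ ∧ v₂ ∧ v₃} Ω^V = i_{v₁} i_{v₂} i_{v₃} Ω^V = Ω^V(v₃, v₂, v₁)`. The result does not depend on
the basis `v` of the vertical space. -/
noncomputable def vertTrivector (π : M → B) (Ω : ∀ p : M, Form (Tan 5 p) 5)
    (ωB : ∀ b : B, Form (Tan 2 b) 2) (γ : ∀ p : M, Tan 5 p →ₗ[ℝ] Tan 5 p) (p : M) :
    MultiVec (Tan 5 p) 3 :=
  (vertVolume π Ω ωB γ p
      ![vertFrame π p 2, vertFrame π p 1, vertFrame π p 0])⁻¹ • vecWedge (vertFrame π p)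

/-- The vertical bivector field `P_β = -i_β Q_V`. -/
noncomputable def vertBivector (π : M → B) (Ω : ∀ p : M, Form (Tan 5 p) 5)
    (ωB : ∀ b : B, Form (Tan 2 b) 2) (γ : ∀ p : M, Tan 5 p →ₗ[ℝ] Tan 5 p)
    (β : ∀ p : M, Dual ℝ (Tan 5 p)) (p : M) : MultiVec (Tan 5 p) 2 :=
  -contractCov (β p) (vertTrivector π Ω ωB γ p)

/-- The bivector field `Π = κ hor^γ ψ + P_β`. -/
noncomputable def tripleBivector (π : M → B) (Ω : ∀ p : M, Form (Tan 5 p) 5)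
    (ωB : ∀ b : B, Form (Tan 2 b) 2) (γ : ∀ p : M, Tan 5 p →ₗ[ℝ] Tan 5 p) (κ : M → ℝ)
    (β : ∀ p : M, Dual ℝ (Tan 5 p)) (p : M) : MultiVec (Tan 5 p) 2 :=
  κ p • pushMultiVec (horLift (n := 2) π γ p) (baseBivector ωB (π p)) + vertBivector π Ω ωB γ β p

/-- The data of a fibered oriented 5-manifold over an oriented surface, together with a triple
`(γ, κ, β)`: `π` is a surjective submersion, `Ω` a volume form on the total space, `ωB` an area
form on the base, `γ` an Ehresmann connection, `κ` a smooth function, and `β` a smooth vertical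
1-form (a section of the annihilator of the horizontal bundle). -/
structure IsFiberedTriple [IsManifold (𝓡 5) ∞ M] [IsManifold (𝓡 2) ∞ B]
    (π : M → B) (Ω : ∀ p : M, Form (Tan 5 p) 5) (ωB : ∀ b : B, Form (Tan 2 b) 2) (γ : ∀ p : M, Tan 5 p →ₗ[ℝ] Tan 5 p) (κ : M → ℝ)
    (β : ∀ p : M, Dual ℝ (Tan 5 p)) : Prop where
  surjective : Function.Surjective π
  submersion : Manifold.IsSubmersion (𝓡 5) (𝓡 2) ∞ π
  smooth_volume : SmoothFormOn Ω univ
  volume_ne_zero : ∀ p, Ω p ≠ 0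
  smooth_area : SmoothFormOn ωB univ
  area_ne_zero : ∀ b, ωB b ≠ 0
  ehresmann : IsEhresmannOn (m := 5) (n := 2) π γ univ
  smooth_kappa : SmoothFunOn 5 κ univ
  smooth_beta : SmoothFormOn
    (fun p => AlternatingMap.ofSubsingleton ℝ (Tan 5 p) ℝ (0 : Fin 1) (β p)) univ
  beta_vertical : ∀ p, β p ∈ (hor γ p).dualAnnihilator

end TwoThree

end AlmostCoupling

/-! Everything is local. Near any point take coordinates `y₀, y₁` on the base, put `xᵢ = yᵢ ∘ π`,
and take horizontal fields `X₀, X₁` dual to `dx₀, dx₁`. With `w = π^*ωB(X₀, X₁)` and `a = κ / w`,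
the tensor becomes `Π = a X₀ ∧ X₁ + P_β`, where the `dxᵢ` are Casimirs of `P_β` because `P_β` is
vertical (`IsSplitOn`, `IsAdaptedFrameOn.isSplitOn`). At a point this already gives the coupling
domain, the horizontal bundle, the coupling form and the uniqueness of `γ`.

The differential statements come from feeding triples of functions to the Jacobi identity of `Π`,
according to how many of the `xᵢ` occur: three arbitrary functions give the Jacobi identity of `P_β`
(`schouten_remainder`); `f, g, x₀` or `f, g, x₁` gives `a L_{X₁} P_β = 0` or `a L_{X₀} P_β = 0`,
hence a Poisson connection where `κ ≠ 0` (`mul_lieDeriv_snd`, `mul_lieDeriv_fst`); `f, x₀, x₁` gives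
`P_β(da, df) = 0` where `a = 0` (`remainder_dAt_coeff`). In the first two cases `f` and `g` (and the
third function) are first corrected by constant multiples of the `xᵢ` so that their derivatives
along `X₀, X₁` vanish at the given point. This does not change their `P_β`-brackets and kills the
unwanted terms.

At a zero of `κ`, `da = dκ / w`, so `P_β(dκ, ·) = 0`. As `P_β` is the contraction of `β` with a
nonzero vertical trivector, this says that `dκ ∘ γ` and `β` are proportional (`covWedge_eq_zero`).
-/

namespace AlmostCoupling

/-! ### Differentials of functions and smooth vector fields -/

section Calculus

variable {n : ℕ} {M : Type*} [TopologicalSpace M] [ChartedSpace (EuclideanSpace ℝ (Fin n)) M]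

theorem SmoothFunOn.mdifferentiableAt {f : M → ℝ} {V : Set M} (hf : SmoothFunOn n f V)
    (hV : IsOpen V) {p : M} (hp : p ∈ V) : MDifferentiableAt (𝓡 n) 𝓘(ℝ, ℝ) f p :=
  ((hf p hp).contMDiffAt (hV.mem_nhds hp)).mdifferentiableAt (by simp)

theorem SmoothFunOn.add {f g : M → ℝ} {V : Set M} (hf : SmoothFunOn n f V)
    (hg : SmoothFunOn n g V) : SmoothFunOn n (fun q => f q + g q) V := ContMDiffOn.add hf hg

theorem SmoothFunOn.sub {f g : M → ℝ} {V : Set M} (hf : SmoothFunOn n f V)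
    (hg : SmoothFunOn n g V) : SmoothFunOn n (fun q => f q - g q) V := ContMDiffOn.sub hf hg

theorem SmoothFunOn.mul {f g : M → ℝ} {V : Set M} (hf : SmoothFunOn n f V)
    (hg : SmoothFunOn n g V) : SmoothFunOn n (fun q => f q * g q) V := ContMDiffOn.mul hf hg

theorem SmoothFunOn.neg {f : M → ℝ} {V : Set M} (hf : SmoothFunOn n f V) :
    SmoothFunOn n (fun q => -f q) V := ContMDiffOn.neg hf

theorem smoothFunOn_const (c : ℝ) (V : Set M) : SmoothFunOn n (fun _ : M => c) V :=
  contMDiffOn_const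

theorem SmoothFunOn.inv {f : M → ℝ} {V : Set M} (hf : SmoothFunOn n f V)
    (h0 : ∀ q ∈ V, f q ≠ 0) : SmoothFunOn n (fun q => (f q)⁻¹) V := ContMDiffOn.inv₀ hf h0

theorem SmoothFunOn.mono {f : M → ℝ} {V W : Set M} (hf : SmoothFunOn n f V) (h : W ⊆ V) :
    SmoothFunOn n f W := ContMDiffOn.mono hf h

theorem SmoothFunOn.congr {f g : M → ℝ} {V : Set M} (hf : SmoothFunOn n f V)
    (h : ∀ q ∈ V, g q = f q) : SmoothFunOn n g V := ContMDiffOn.congr hf h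

theorem smoothFunOn_of_locally {f : M → ℝ} {V : Set M}
    (h : ∀ p ∈ V, ∃ W, IsOpen W ∧ p ∈ W ∧ SmoothFunOn n f W) : SmoothFunOn n f V := fun p hp =>
  let ⟨_, hW, hpW, hf⟩ := h p hp
  ((hf p hpW).contMDiffAt (hW.mem_nhds hpW)).contMDiffWithinAt

theorem dAt_congr {f g : M → ℝ} {V : Set M} (hV : IsOpen V) {p : M} (hp : p ∈ V)
    (h : ∀ q ∈ V, f q = g q) : dAt (n := n) f p = dAt g p := by
  have h' : f =ᶠ[nhds p] g := Filter.eventuallyEq_of_mem (hV.mem_nhds hp) h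
  ext v
  simp only [dAt, mvfderiv, ContinuousLinearMap.coe_coe, ContinuousLinearMap.coe_comp,
    Function.comp_apply]
  rw [h'.mfderiv_eq]
  rfl

theorem dAt_const (c : ℝ) (p : M) : dAt (n := n) (fun _ : M => c) p = 0 := by
  ext v
  simp [dAt, mvfderiv_const]

theorem dAt_add {f g : M → ℝ} {p : M} (hf : MDifferentiableAt (𝓡 n) 𝓘(ℝ, ℝ) f p)
    (hg : MDifferentiableAt (𝓡 n) 𝓘(ℝ, ℝ) g p) :
    dAt (n := n) (fun q => f q + g q) p = dAt f p + dAt g p := by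
  have := mvfderiv_add hf hg
  exact congrArg ContinuousLinearMap.toLinearMap this

theorem dAt_sub {f g : M → ℝ} {p : M} (hf : MDifferentiableAt (𝓡 n) 𝓘(ℝ, ℝ) f p)
    (hg : MDifferentiableAt (𝓡 n) 𝓘(ℝ, ℝ) g p) :
    dAt (n := n) (fun q => f q - g q) p = dAt f p - dAt g p := by
  have := mvfderiv_sub hf hg
  exact congrArg ContinuousLinearMap.toLinearMap this

theorem dAt_neg (f : M → ℝ) (p : M) : dAt (n := n) (fun q => -f q) p = -dAt f p := by
  have := mvfderiv_neg (I := 𝓡 n) (g := f) (x := p)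
  exact congrArg ContinuousLinearMap.toLinearMap this

theorem dAt_mul {f g : M → ℝ} {p : M} (hf : MDifferentiableAt (𝓡 n) 𝓘(ℝ, ℝ) f p)
    (hg : MDifferentiableAt (𝓡 n) 𝓘(ℝ, ℝ) g p) :
    dAt (n := n) (fun q => f q * g q) p = f p • dAt g p + g p • dAt f p := by
  have := mvfderiv_mul hf hg
  exact congrArg ContinuousLinearMap.toLinearMap this

theorem dAt_const_mul (c : ℝ) {f : M → ℝ} {p : M}
    (hf : MDifferentiableAt (𝓡 n) 𝓘(ℝ, ℝ) f p) :
    dAt (n := n) (fun q => c * f q) p = c • dAt f p := by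
  rw [dAt_mul mdifferentiableAt_const hf, dAt_const]
  simp

section VectorFields

variable [IsManifold (𝓡 n) ∞ M]

theorem SmoothVecOn.mono {X : ∀ p : M, Tan n p} {V W : Set M} (hX : SmoothVecOn X V)
    (h : W ⊆ V) : SmoothVecOn X W := ContMDiffOn.mono hX h

theorem SmoothVecOn.sub {X Y : ∀ p : M, Tan n p} {V : Set M} (hX : SmoothVecOn X V)
    (hY : SmoothVecOn Y V) : SmoothVecOn (fun p => X p - Y p) V := ContMDiffOn.sub_section hX hY

theorem SmoothVecOn.smul {X : ∀ p : M, Tan n p} {f : M → ℝ} {V : Set M}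
    (hf : SmoothFunOn n f V) (hX : SmoothVecOn X V) : SmoothVecOn (fun p => f p • X p) V :=
  ContMDiffOn.smul_section hf hX

/-- `df(X)` is the fibre coordinate of the composite of the tangent map of `f` with the section `X`.
-/
theorem SmoothFunOn.dAt_apply {f : M → ℝ} {X : ∀ p : M, Tan n p} {V : Set M} (hV : IsOpen V)
    (hf : SmoothFunOn n f V) (hX : SmoothVecOn X V) :
    SmoothFunOn n (fun q => dAt f q (X q)) V := by
  have : IsManifold (𝓡 n) 1 M := IsManifold.of_le (n := ∞) (by simp)
  have h1 := ContMDiffOn.contMDiffOn_tangentMapWithin (m := ∞) hf (by simp) hV.uniqueMDiffOn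
  have h2 := h1.comp hX (fun q hq => hq)
  have h3 := (contMDiff_snd_tangentBundle_modelSpace (n := ∞) ℝ 𝓘(ℝ, ℝ)).comp_contMDiffOn h2
  refine ContMDiffOn.congr h3 fun q hq => ?_
  have h4 : (((fun p => p.snd) ∘ tangentMapWithin (𝓡 n) 𝓘(ℝ, ℝ) f V ∘
      fun p => (⟨p, X p⟩ : TangentBundle (𝓡 n) M)) q : ℝ) =
      mfderivWithin (𝓡 n) 𝓘(ℝ, ℝ) f V q (X q) := rfl
  rw [h4, mfderivWithin_of_isOpen hV hq]
  rfl

/-- Every tangent vector extends to a smooth local vector field. -/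
theorem exists_smoothVecOn_eq (p : M) (v : Tan n p) :
    ∃ (V : Set M) (X : ∀ q : M, Tan n q), IsOpen V ∧ p ∈ V ∧ SmoothVecOn X V ∧ X p = v := by
  let e := trivializationAt (EuclideanSpace ℝ (Fin n)) (TangentSpace (𝓡 n) : M → Type _) p
  have hp : p ∈ e.baseSet := FiberBundle.mem_baseSet_trivializationAt' p
  let b := (EuclideanSpace.basisFun (Fin n) ℝ).toBasis
  have hb := e.isLocalFrameOn_localFrame_baseSet (𝓡 n) ∞ b
  refine ⟨e.baseSet, fun q => ∑ i, (hb.toBasisAt hp).repr v i • e.localFrame b i q,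
    e.open_baseSet, hp, ?_, ?_⟩
  · refine ContMDiffOn.sum_section fun i _ => ContMDiffOn.const_smul_section ?_
    exact e.contMDiffOn_localFrame_baseSet ∞ b i
  · simpa only [IsLocalFrameOn.toBasisAt_coe] using (hb.toBasisAt hp).sum_repr v

/-- Every covector is the differential of a smooth local function. -/
theorem exists_dAt_eq (p : M) (α : Dual ℝ (Tan n p)) :
    ∃ (V : Set M) (f : M → ℝ), IsOpen V ∧ p ∈ V ∧ SmoothFunOn n f V ∧ dAt f p = α := by
  have : IsManifold (𝓡 n) 1 M := IsManifold.of_le (n := ∞) (by simp)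
  let l : EuclideanSpace ℝ (Fin n) →L[ℝ] ℝ :=
    LinearMap.toContinuousLinearMap (show EuclideanSpace ℝ (Fin n) →ₗ[ℝ] ℝ from α)
  have hφ : ContMDiffOn (𝓡 n) 𝓘(ℝ, EuclideanSpace ℝ (Fin n)) ∞ (extChartAt (𝓡 n) p)
    (chartAt (EuclideanSpace ℝ (Fin n)) p).source := contMDiffOn_extChartAt
  refine ⟨_, fun q => l (extChartAt (𝓡 n) p q),
    (chartAt (EuclideanSpace ℝ (Fin n)) p).open_source, mem_chart_source _ p, ?_, ?_⟩
  · exact l.contMDiff.comp_contMDiffOn hφ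
  · have h1 : MDifferentiableAt (𝓡 n) 𝓘(ℝ, EuclideanSpace ℝ (Fin n)) (extChartAt (𝓡 n) p) p :=
      mdifferentiableAt_extChartAt (mem_chart_source _ p)
    have h2 : MDifferentiableAt 𝓘(ℝ, EuclideanSpace ℝ (Fin n)) 𝓘(ℝ, ℝ) l
        (extChartAt (𝓡 n) p p) := l.mdifferentiableAt
    have h3 : mfderiv (𝓡 n) 𝓘(ℝ, ℝ) (l ∘ extChartAt (𝓡 n) p) p =
        (mfderiv 𝓘(ℝ, EuclideanSpace ℝ (Fin n)) 𝓘(ℝ, ℝ) l (extChartAt (𝓡 n) p p)).comp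
          (mfderiv (𝓡 n) 𝓘(ℝ, EuclideanSpace ℝ (Fin n)) (extChartAt (𝓡 n) p) p) :=
      mfderiv_comp p h2 h1
    -- The tangent space at `p` is identified with the model space through the preferred chart at
    -- `p`, so the derivative of that chart at `p` is the identity.
    rw [mfderiv_extChartAt_self, ContinuousLinearMap.mfderiv_eq] at h3
    ext v
    exact congrArg (fun L => (L v : ℝ)) h3

end VectorFields

end Calculus

/-! ### Bilinearity of bivectors -/

section Bivector

variable {T : Type*} [AddCommGroup T] [Module ℝ T]

theorem sharpBidual_apply (Q : MultiVec T 2) (α β : Dual ℝ T) :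
    sharpBidual Q α β = Q ![α, β] := rfl

theorem bivector_swap (Q : MultiVec T 2) (α β : Dual ℝ T) : Q ![α, β] = -Q ![β, α] := by
  have h := Q.map_swap ![β, α] (i := 0) (j := 1) (by decide)
  rw [← h]
  congr 1
  ext i
  fin_cases i <;> rfl

theorem bivector_add_left (Q : MultiVec T 2) (α α' β : Dual ℝ T) :
    Q ![α + α', β] = Q ![α, β] + Q ![α', β] := by simp [← sharpBidual_apply]

theorem bivector_sub_left (Q : MultiVec T 2) (α α' β : Dual ℝ T) :
    Q ![α - α', β] = Q ![α, β] - Q ![α', β] := by simp [← sharpBidual_apply]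

theorem bivector_neg_left (Q : MultiVec T 2) (α β : Dual ℝ T) :
    Q ![-α, β] = -Q ![α, β] := by simp [← sharpBidual_apply]

theorem bivector_smul_left (Q : MultiVec T 2) (c : ℝ) (α β : Dual ℝ T) :
    Q ![c • α, β] = c * Q ![α, β] := by simp [← sharpBidual_apply]

end Bivector

/-! ### Consequences of the Jacobi identity for `a X₀ ∧ X₁ + P` -/

section Splitting

variable {n : ℕ} {M : Type*} [TopologicalSpace M] [ChartedSpace (EuclideanSpace ℝ (Fin n)) M]

theorem SmoothMultiVecOn.bracket {P : ∀ p : M, MultiVec (Tan n p) 2} {U V : Set M}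
    (hP : SmoothMultiVecOn P U) (hV : IsOpen V) (hVU : V ⊆ U) {f g : M → ℝ}
    (hf : SmoothFunOn n f V) (hg : SmoothFunOn n g V) :
    SmoothFunOn n (bracket P f g) V := by
  refine (hP V hV hVU ![f, g] ?_).congr fun q _ => ?_
  · intro i
    fin_cases i
    exacts [hf, hg]
  · simp only [AlmostCoupling.bracket]
    congr 1
    ext i
    fin_cases i <;> rfl

theorem SmoothMultiVecOn.mono {k : ℕ} {P : ∀ p : M, MultiVec (Tan n p) k} {U V : Set M}
    (hP : SmoothMultiVecOn P U) (h : V ⊆ U) : SmoothMultiVecOn P V :=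
  fun W hW hWV => hP W hW (hWV.trans h)

theorem IsPoissonOn.mono {P : ∀ p : M, MultiVec (Tan n p) 2} {U V : Set M}
    (hP : IsPoissonOn P U) (h : V ⊆ U) : IsPoissonOn P V :=
  ⟨hP.1.mono h, fun W hW hWV => hP.2 W hW (hWV.trans h)⟩

theorem bracket_swap (P : ∀ p : M, MultiVec (Tan n p) 2) (f g : M → ℝ) (p : M) :
    bracket P f g p = -bracket P g f p := bivector_swap _ _ _

theorem schouten_self (P : ∀ p : M, MultiVec (Tan n p) 2) (f g h : M → ℝ) (p : M) :
    schouten P P f g h p = 2 * (bracket P (bracket P f g) h p + bracket P (bracket P g h) f p +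
      bracket P (bracket P h f) g p) := by
  simp only [schouten]; ring

variable [IsManifold (𝓡 n) ∞ M]

/-- On the open set `V`, the bivector field `Q` splits as `a X₀ ∧ X₁ + P`, where the vector fields
`X₀, X₁` are dual to the differentials of the functions `x₀, x₁`, which are Casimirs of `P`. -/
structure IsSplitOn (Q P : ∀ p : M, MultiVec (Tan n p) 2) (a x₀ x₁ : M → ℝ)
    (X₀ X₁ : ∀ p : M, Tan n p) (V : Set M) : Prop where
  isOpen : IsOpen V
  smooth_coeff : SmoothFunOn n a V
  smooth_fst : SmoothFunOn n x₀ V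
  smooth_snd : SmoothFunOn n x₁ V
  smooth_vec_fst : SmoothVecOn X₀ V
  smooth_vec_snd : SmoothVecOn X₁ V
  fst_fst : ∀ q ∈ V, dAt x₀ q (X₀ q) = 1
  fst_snd : ∀ q ∈ V, dAt x₀ q (X₁ q) = 0
  snd_fst : ∀ q ∈ V, dAt x₁ q (X₀ q) = 0
  snd_snd : ∀ q ∈ V, dAt x₁ q (X₁ q) = 1
  casimir_fst : ∀ q ∈ V, ∀ α, P q ![dAt x₀ q, α] = 0
  casimir_snd : ∀ q ∈ V, ∀ α, P q ![dAt x₁ q, α] = 0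
  eq : ∀ q ∈ V, ∀ α β, Q q ![α, β] = a q * (α (X₀ q) * β (X₁ q) - α (X₁ q) * β (X₀ q)) +
    P q ![α, β]

namespace IsSplitOn

variable {Q P : ∀ p : M, MultiVec (Tan n p) 2} {a x₀ x₁ : M → ℝ}
    {X₀ X₁ : ∀ p : M, Tan n p} {V W : Set M}

/-- By antisymmetry of `X₀ ∧ X₁` only the sign of the coefficient changes, so statements about `X₀`
follow from those about `X₁`. -/
theorem swap (h : IsSplitOn Q P a x₀ x₁ X₀ X₁ V) :
    IsSplitOn Q P (fun q => -a q) x₁ x₀ X₁ X₀ V where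
  isOpen := h.isOpen
  smooth_coeff := h.smooth_coeff.neg
  smooth_fst := h.smooth_snd
  smooth_snd := h.smooth_fst
  smooth_vec_fst := h.smooth_vec_snd
  smooth_vec_snd := h.smooth_vec_fst
  fst_fst := h.snd_snd
  fst_snd := h.snd_fst
  snd_fst := h.fst_snd
  snd_snd := h.fst_fst
  casimir_fst := h.casimir_snd
  casimir_snd := h.casimir_fst
  eq := fun q hq α β => by rw [h.eq q hq]; ring

theorem mono (h : IsSplitOn Q P a x₀ x₁ X₀ X₁ V) (hW : IsOpen W) (hWV : W ⊆ V) :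
    IsSplitOn Q P a x₀ x₁ X₀ X₁ W where
  isOpen := hW
  smooth_coeff := h.smooth_coeff.mono hWV
  smooth_fst := h.smooth_fst.mono hWV
  smooth_snd := h.smooth_snd.mono hWV
  smooth_vec_fst := h.smooth_vec_fst.mono hWV
  smooth_vec_snd := h.smooth_vec_snd.mono hWV
  fst_fst := fun q hq => h.fst_fst q (hWV hq)
  fst_snd := fun q hq => h.fst_snd q (hWV hq)
  snd_fst := fun q hq => h.snd_fst q (hWV hq)
  snd_snd := fun q hq => h.snd_snd q (hWV hq)
  casimir_fst := fun q hq => h.casimir_fst q (hWV hq)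
  casimir_snd := fun q hq => h.casimir_snd q (hWV hq)
  eq := fun q hq => h.eq q (hWV hq)

theorem casimir_fst_right (h : IsSplitOn Q P a x₀ x₁ X₀ X₁ V) {q : M} (hq : q ∈ V)
    (α : Dual ℝ (Tan n q)) : P q ![α, dAt x₀ q] = 0 := by
  rw [bivector_swap, h.casimir_fst q hq, neg_zero]

theorem bracket_eq (h : IsSplitOn Q P a x₀ x₁ X₀ X₁ V) (f g : M → ℝ) {q : M} (hq : q ∈ V) :
    bracket Q f g q = a q * (dAt f q (X₀ q) * dAt g q (X₁ q) - dAt f q (X₁ q) * dAt g q (X₀ q))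
      + bracket P f g q := h.eq q hq _ _

theorem bracket_fst_right (h : IsSplitOn Q P a x₀ x₁ X₀ X₁ V) (g : M → ℝ) {q : M} (hq : q ∈ V) :
    bracket Q g x₀ q = -(a q * dAt g q (X₁ q)) := by
  rw [h.bracket_eq g x₀ hq, h.fst_fst q hq, h.fst_snd q hq, bracket, h.casimir_fst_right hq]
  ring

theorem bracket_fst_left (h : IsSplitOn Q P a x₀ x₁ X₀ X₁ V) (g : M → ℝ) {q : M} (hq : q ∈ V) :
    bracket Q x₀ g q = a q * dAt g q (X₁ q) := by
  rw [bracket_swap, h.bracket_fst_right g hq, neg_neg]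

/-- Smoothness of `P` is not part of the splitting: `P` is the difference of the smooth tensors `Q`
and `a X₀ ∧ X₁`. -/
theorem smooth_remainder (h : IsSplitOn Q P a x₀ x₁ X₀ X₁ V) (hQ : SmoothMultiVecOn Q V)
    {f g : M → ℝ} (hf : SmoothFunOn n f V) (hg : SmoothFunOn n g V) :
    SmoothFunOn n (bracket P f g) V := by
  have h0 := h.smooth_vec_fst
  have h1 := h.smooth_vec_snd
  refine ((hQ.bracket h.isOpen subset_rfl hf hg).sub (h.smooth_coeff.mul
    (((hf.dAt_apply h.isOpen h0).mul (hg.dAt_apply h.isOpen h1)).sub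
      ((hf.dAt_apply h.isOpen h1).mul (hg.dAt_apply h.isOpen h0))))).congr fun q hq => ?_
  rw [h.bracket_eq f g hq]
  ring

/-- Subtracting a combination of the Casimirs makes the derivatives along the frame vanish at a
point, without changing the brackets with respect to `P`. -/
theorem exists_shift (h : IsSplitOn Q P a x₀ x₁ X₀ X₁ V) (p : M) {f : M → ℝ}
    (hf : SmoothFunOn n f V) :
    ∃ f' : M → ℝ, SmoothFunOn n f' V ∧ (∀ q ∈ V, ∀ α, P q ![dAt f' q, α] = P q ![dAt f q, α]) ∧
      (∀ q ∈ V, dAt f' q (X₀ q) = dAt f q (X₀ q) - dAt f p (X₀ p)) ∧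
      (∀ q ∈ V, dAt f' q (X₁ q) = dAt f q (X₁ q) - dAt f p (X₁ p)) := by
  have hd : ∀ q ∈ V,
      dAt (n := n) (fun q => f q - (dAt f p (X₀ p) * x₀ q + dAt f p (X₁ p) * x₁ q)) q =
        dAt f q - (dAt f p (X₀ p) • dAt x₀ q + dAt f p (X₁ p) • dAt x₁ q) := by
    intro q hq
    have m0 := h.smooth_fst.mdifferentiableAt h.isOpen hq
    have m1 := h.smooth_snd.mdifferentiableAt h.isOpen hq
    have c0 := ((smoothFunOn_const (n := n) (dAt f p (X₀ p)) V).mul h.smooth_fst)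
    have c1 := ((smoothFunOn_const (n := n) (dAt f p (X₁ p)) V).mul h.smooth_snd)
    rw [dAt_sub (hf.mdifferentiableAt h.isOpen hq) ((c0.add c1).mdifferentiableAt h.isOpen hq),
      dAt_add (c0.mdifferentiableAt h.isOpen hq) (c1.mdifferentiableAt h.isOpen hq),
      dAt_const_mul _ m0, dAt_const_mul _ m1]
  refine ⟨fun q => f q - (dAt f p (X₀ p) * x₀ q + dAt f p (X₁ p) * x₁ q),
    hf.sub (((smoothFunOn_const _ V).mul h.smooth_fst).add
      ((smoothFunOn_const _ V).mul h.smooth_snd)), fun q hq α => ?_, fun q hq => ?_,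
      fun q hq => ?_⟩
  · rw [hd q hq, bivector_sub_left, bivector_add_left, bivector_smul_left, bivector_smul_left,
      h.casimir_fst q hq, h.casimir_snd q hq]
    ring
  · rw [hd q hq]
    simp [h.fst_fst q hq, h.snd_fst q hq]
  · rw [hd q hq]
    simp [h.fst_snd q hq, h.snd_snd q hq]

/-- The two brackets differ by `a` times a sum of products of two functions that both vanish at `p`,
so the difference vanishes to second order. -/
theorem dAt_bracket (h : IsSplitOn Q P a x₀ x₁ X₀ X₁ V) (hQ : SmoothMultiVecOn Q V)
    {f g : M → ℝ} (hf : SmoothFunOn n f V) (hg : SmoothFunOn n g V) {p : M} (hp : p ∈ V)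
    (hf0 : dAt f p (X₀ p) = 0) (hf1 : dAt f p (X₁ p) = 0)
    (hg0 : dAt g p (X₀ p) = 0) (hg1 : dAt g p (X₁ p) = 0) :
    dAt (n := n) (bracket Q f g) p = dAt (bracket P f g) p := by
  have hV := h.isOpen
  have f0 := hf.dAt_apply hV h.smooth_vec_fst
  have f1 := hf.dAt_apply hV h.smooth_vec_snd
  have g0 := hg.dAt_apply hV h.smooth_vec_fst
  have g1 := hg.dAt_apply hV h.smooth_vec_snd
  have hD := (f0.mul g1).sub (f1.mul g0)
  rw [dAt_congr hV hp fun q hq => h.bracket_eq f g hq,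
    dAt_add ((h.smooth_coeff.mul hD).mdifferentiableAt hV hp)
      ((h.smooth_remainder hQ hf hg).mdifferentiableAt hV hp),
    dAt_mul (h.smooth_coeff.mdifferentiableAt hV hp) (hD.mdifferentiableAt hV hp),
    dAt_sub ((f0.mul g1).mdifferentiableAt hV hp) ((f1.mul g0).mdifferentiableAt hV hp),
    dAt_mul (f0.mdifferentiableAt hV hp) (g1.mdifferentiableAt hV hp),
    dAt_mul (f1.mdifferentiableAt hV hp) (g0.mdifferentiableAt hV hp), hf0, hf1, hg0, hg1]
  simp

theorem bracket_eq_of_left_eq_zero (h : IsSplitOn Q P a x₀ x₁ X₀ X₁ V) {f g : M → ℝ} {p : M}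
    (hp : p ∈ V) (hg0 : dAt g p (X₀ p) = 0) (hg1 : dAt g p (X₁ p) = 0) :
    bracket Q f g p = bracket P f g p := by
  rw [h.bracket_eq f g hp, hg0, hg1]
  ring

/-- The remainder of a split Poisson tensor satisfies the Jacobi identity. -/
theorem schouten_remainder (h : IsSplitOn Q P a x₀ x₁ X₀ X₁ V) (hQ : IsPoissonOn Q V)
    {f g k : M → ℝ} (hf : SmoothFunOn n f V) (hg : SmoothFunOn n g V) (hk : SmoothFunOn n k V)
    {p : M} (hp : p ∈ V) : schouten P P f g k p = 0 := by
  -- One double bracket of the Jacobi sum; rotating the functions gives the other two. For the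
  -- shifted functions the inner brackets have equal differentials at `p`, and the outer bracket
  -- sees no horizontal term.
  have key : ∀ {f g k f' g' k' : M → ℝ}, SmoothFunOn n f' V → SmoothFunOn n g' V →
      (∀ q ∈ V, ∀ α, P q ![dAt f' q, α] = P q ![dAt f q, α]) →
      (∀ q ∈ V, ∀ α, P q ![dAt g' q, α] = P q ![dAt g q, α]) →
      (∀ q ∈ V, ∀ α, P q ![dAt k' q, α] = P q ![dAt k q, α]) →
      dAt f' p (X₀ p) = 0 → dAt f' p (X₁ p) = 0 → dAt g' p (X₀ p) = 0 → dAt g' p (X₁ p) = 0 →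
      dAt k' p (X₀ p) = 0 → dAt k' p (X₁ p) = 0 →
      bracket P (bracket P f g) k p = bracket Q (bracket Q f' g') k' p := by
    intro f g k f' g' k' sf sg ef eg ek f0 f1 g0 g1 k0 k1
    have e1 : ∀ q ∈ V, bracket P f g q = bracket P f' g' q := fun q hq => by
      simp only [bracket]
      rw [← ef q hq, bivector_swap, ← eg q hq, bivector_swap, neg_neg]
    rw [h.bracket_eq_of_left_eq_zero hp k0 k1]
    unfold bracket
    have e2 := h.dAt_bracket hQ.1 sf sg hp f0 f1 g0 g1
    have e3 := dAt_congr (n := n) h.isOpen hp e1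
    unfold bracket at e2 e3
    rw [e2, ← e3, bivector_swap, ← ek p hp, bivector_swap, neg_neg]
  obtain ⟨f', sf, ef, f0, f1⟩ := h.exists_shift p hf
  obtain ⟨g', sg, eg, g0, g1⟩ := h.exists_shift p hg
  obtain ⟨k', sk, ek, k0, k1⟩ := h.exists_shift p hk
  replace f0 := (f0 p hp).trans (sub_self _)
  replace f1 := (f1 p hp).trans (sub_self _)
  replace g0 := (g0 p hp).trans (sub_self _)
  replace g1 := (g1 p hp).trans (sub_self _)
  replace k0 := (k0 p hp).trans (sub_self _)
  replace k1 := (k1 p hp).trans (sub_self _)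
  have := hQ.2 V h.isOpen subset_rfl f' g' k' sf sg sk p hp
  rw [schouten_self] at this ⊢
  rw [key sf sg ef eg ek f0 f1 g0 g1 k0 k1, key sg sk eg ek ef g0 g1 k0 k1 f0 f1,
    key sk sf ek ef eg k0 k1 f0 f1 g0 g1, this]

/-- The bracket of `Q` with `x₀` is the derivation `-a X₁`. The Jacobi identity for `f, g, x₀`
therefore says that `a X₁` acts as a derivation of the bracket of `P`, up to terms in `da` that the
shift of `f` and `g` removes. -/
theorem mul_lieDeriv_snd (h : IsSplitOn Q P a x₀ x₁ X₀ X₁ V) (hQ : IsPoissonOn Q V)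
    {f g : M → ℝ} (hf : SmoothFunOn n f V) (hg : SmoothFunOn n g V)
    {p : M} (hp : p ∈ V) : a p * lieDeriv X₁ P f g p = 0 := by
  have hV := h.isOpen
  obtain ⟨f', sf, ef, f0, f1⟩ := h.exists_shift p hf
  obtain ⟨g', sg, eg, g0, g1⟩ := h.exists_shift p hg
  have f0p := (f0 p hp).trans (sub_self _)
  have f1p := (f1 p hp).trans (sub_self _)
  have g0p := (g0 p hp).trans (sub_self _)
  have g1p := (g1 p hp).trans (sub_self _)
  have sf1 := sf.dAt_apply hV h.smooth_vec_snd
  have sg1 := sg.dAt_apply hV h.smooth_vec_snd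
  have e1 : ∀ q ∈ V, bracket P f g q = bracket P f' g' q := fun q hq => by
    simp only [bracket]
    rw [← ef q hq, bivector_swap, ← eg q hq, bivector_swap, neg_neg]
  -- The shift changes the derivative along `X₁` by a constant on all of `V`, not only at `p`, so
  -- the differential of that derivative is unchanged.
  have dconst : ∀ {f f' : M → ℝ} {c : ℝ}, SmoothFunOn n f V →
      (∀ q ∈ V, dAt f' q (X₁ q) = dAt f q (X₁ q) - c) →
      dAt (n := n) (fun q => dAt f q (X₁ q)) p = dAt (fun q => dAt f' q (X₁ q)) p := by
    intro f f' c hf e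
    rw [dAt_congr hV hp e, dAt_sub ((hf.dAt_apply hV h.smooth_vec_snd).mdifferentiableAt hV hp)
      mdifferentiableAt_const, dAt_const, sub_zero]
  have jac := hQ.2 V hV subset_rfl f' g' x₀ sf sg h.smooth_fst p hp
  rw [schouten_self, h.bracket_fst_right _ hp, h.dAt_bracket hQ.1 sf sg hp f0p f1p g0p g1p,
    h.bracket_eq_of_left_eq_zero hp f0p f1p, h.bracket_eq_of_left_eq_zero hp g0p g1p] at jac
  -- The product rule also yields `X₁ g' • da`, which vanishes at `p` by the choice of `g'`.
  have d1 : dAt (n := n) (bracket Q g' x₀) p = -(a p • dAt (fun q => dAt g' q (X₁ q)) p) := by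
    rw [dAt_congr hV hp fun q hq => h.bracket_fst_right g' hq, dAt_neg,
      dAt_mul (h.smooth_coeff.mdifferentiableAt hV hp) (sg1.mdifferentiableAt hV hp), g1p]
    simp
  have d2 : dAt (n := n) (bracket Q x₀ f') p = a p • dAt (fun q => dAt f' q (X₁ q)) p := by
    rw [dAt_congr hV hp fun q hq => h.bracket_fst_left f' hq,
      dAt_mul (h.smooth_coeff.mdifferentiableAt hV hp) (sf1.mdifferentiableAt hV hp), f1p]
    simp
  have b1 : bracket P (bracket Q g' x₀) f' p =
      -(a p * P p ![dAt (fun q => dAt g' q (X₁ q)) p, dAt f' p]) := by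
    simp only [bracket] at d1 ⊢
    rw [d1, bivector_neg_left, bivector_smul_left]
  have b2 : bracket P (bracket Q x₀ f') g' p =
      a p * P p ![dAt (fun q => dAt f' q (X₁ q)) p, dAt g' p] := by
    simp only [bracket] at d2 ⊢
    rw [d2, bivector_smul_left]
  rw [b1, b2] at jac
  have l : lieDeriv X₁ P f g p = dAt (bracket P f' g') p (X₁ p)
      - P p ![dAt (fun q => dAt f' q (X₁ q)) p, dAt g' p]
      + P p ![dAt (fun q => dAt g' q (X₁ q)) p, dAt f' p] := by
    rw [lieDeriv, dAt_congr hV hp e1, bracket, bracket, dconst hf f1, dconst hg g1,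
      bivector_swap _ _ (dAt g p), ← eg p hp, ← ef p hp, bivector_swap _ (dAt g' p),
      bivector_swap _ (dAt f' p)]
    ring
  rw [l]
  linear_combination -(1 / 2) * jac

theorem mul_lieDeriv_fst (h : IsSplitOn Q P a x₀ x₁ X₀ X₁ V) (hQ : IsPoissonOn Q V)
    {f g : M → ℝ} (hf : SmoothFunOn n f V) (hg : SmoothFunOn n g V)
    {p : M} (hp : p ∈ V) : a p * lieDeriv X₀ P f g p = 0 := by
  have := h.swap.mul_lieDeriv_snd hQ hf hg hp
  linarith

/-- At the zeros of the coefficient, its differential is a Casimir of the remainder. -/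
theorem remainder_dAt_coeff (h : IsSplitOn Q P a x₀ x₁ X₀ X₁ V) (hQ : IsPoissonOn Q V)
    {f : M → ℝ} (hf : SmoothFunOn n f V) {p : M} (hp : p ∈ V) (ha : a p = 0) :
    P p ![dAt a p, dAt f p] = 0 := by
  have hV := h.isOpen
  -- The inner bracket of `x₀, x₁` is `a`. The other two double brackets end in `x₀` or `x₁`, hence
  -- carry the factor `a p = 0`.
  have jac := hQ.2 V hV subset_rfl f x₀ x₁ hf h.smooth_fst h.smooth_snd p hp
  have hx : dAt (n := n) (bracket Q x₀ x₁) p = dAt a p := dAt_congr hV hp fun q hq => by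
    rw [h.bracket_fst_left x₁ hq, h.snd_snd q hq, mul_one]
  have hb : bracket Q (bracket Q x₀ x₁) f p = P p ![dAt a p, dAt f p] := by
    rw [h.bracket_eq _ _ hp, ha, zero_mul, zero_add, bracket, hx]
  rw [schouten_self, hb, h.swap.bracket_fst_right _ hp, h.bracket_fst_right _ hp, ha] at jac
  linarith

/-- The Lie derivative is not linear over functions in `X`, but the defect involves only `P(dφᵢ,
·)`. This is what reduces arbitrary horizontal lifts to `X₀` and `X₁`. -/
theorem lieDeriv_combination (h : IsSplitOn Q P a x₀ x₁ X₀ X₁ V)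
    {X : ∀ p : M, Tan n p} {φ₀ φ₁ : M → ℝ} (hφ₀ : SmoothFunOn n φ₀ V) (hφ₁ : SmoothFunOn n φ₁ V)
    {p : M} (hp : p ∈ V) (hX : ∀ q ∈ V, X q = φ₀ q • X₀ q + φ₁ q • X₁ q)
    (c₀ : ∀ α, P p ![dAt φ₀ p, α] = 0) (c₁ : ∀ α, P p ![dAt φ₁ p, α] = 0)
    {f g : M → ℝ} (hf : SmoothFunOn n f V) (hg : SmoothFunOn n g V) :
    lieDeriv X P f g p = φ₀ p * lieDeriv X₀ P f g p + φ₁ p * lieDeriv X₁ P f g p := by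
  have hV := h.isOpen
  have key : ∀ {f : M → ℝ}, SmoothFunOn n f V → ∀ α, P p ![dAt (fun q => dAt f q (X q)) p, α] =
      φ₀ p * P p ![dAt (fun q => dAt f q (X₀ q)) p, α] +
      φ₁ p * P p ![dAt (fun q => dAt f q (X₁ q)) p, α] := by
    intro f hf α
    have f0 := hf.dAt_apply hV h.smooth_vec_fst
    have f1 := hf.dAt_apply hV h.smooth_vec_snd
    have e : ∀ q ∈ V, dAt f q (X q) = φ₀ q * dAt f q (X₀ q) + φ₁ q * dAt f q (X₁ q) :=
      fun q hq => by rw [hX q hq]; simp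
    rw [dAt_congr hV hp e, dAt_add ((hφ₀.mul f0).mdifferentiableAt hV hp)
      ((hφ₁.mul f1).mdifferentiableAt hV hp),
      dAt_mul (hφ₀.mdifferentiableAt hV hp) (f0.mdifferentiableAt hV hp),
      dAt_mul (hφ₁.mdifferentiableAt hV hp) (f1.mdifferentiableAt hV hp)]
    simp only [bivector_add_left, bivector_smul_left, c₀, c₁]
    ring
  simp only [lieDeriv, bracket]
  rw [key hf, bivector_swap _ (dAt f p) (dAt (fun q => dAt g q (X q)) p), key hg,
    bivector_swap _ (dAt f p), bivector_swap _ (dAt f p), hX p hp]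
  simp only [map_add, map_smul, smul_eq_mul]
  ring

end IsSplitOn

end Splitting

/-! ### Two-forms and bivectors evaluated on pairs -/

section Pairs

variable {T : Type*} [AddCommGroup T] [Module ℝ T]

theorem form_add_left (η : Form T 2) (u u' v : T) :
    η ![u + u', v] = η ![u, v] + η ![u', v] := η.map_vecCons_add ![v] u u'

theorem form_smul_left (η : Form T 2) (c : ℝ) (u v : T) :
    η ![c • u, v] = c * η ![u, v] := η.map_vecCons_smul ![v] c u

theorem form_swap (η : Form T 2) (u v : T) : η ![u, v] = -η ![v, u] := by
  have h := η.map_swap ![v, u] (i := 0) (j := 1) (by decide)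
  rw [← h]
  congr 1
  ext i
  fin_cases i <;> rfl

theorem form_self (η : Form T 2) (u : T) : η ![u, u] = 0 := by
  have := form_swap η u u
  linarith

theorem form_combination (η : Form T 2) (a b c d : ℝ) (u v : T) :
    η ![a • u + b • v, c • u + d • v] = (a * d - b * c) * η ![u, v] := by
  rw [form_add_left, form_smul_left, form_smul_left, form_swap, form_add_left, form_smul_left,
    form_smul_left, form_swap _ v (c • u + d • v), form_add_left, form_smul_left, form_smul_left,
    form_self, form_self, form_swap _ v u]
  ring

theorem vecWedge_pair (v : Fin 2 → T) (α β : Dual ℝ T) :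
    vecWedge v ![α, β] = α (v 0) * β (v 1) - α (v 1) * β (v 0) := by
  rw [vecWedge_apply, Matrix.det_fin_two]
  rfl

theorem covWedge_pair (α β : Dual ℝ T) (v : Fin 2 → T) :
    covWedge ![α, β] v = α (v 0) * β (v 1) - α (v 1) * β (v 0) := by
  rw [covWedge_apply, Matrix.det_fin_two]
  simp [mul_comm]

theorem pushMultiVec_pair {S : Type*} [AddCommGroup S] [Module ℝ S] (h : S →ₗ[ℝ] T)
    (Q : MultiVec S 2) (α β : Dual ℝ T) :
    pushMultiVec h Q ![α, β] = Q ![α ∘ₗ h, β ∘ₗ h] := by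
  rw [pushMultiVec, AlternatingMap.compLinearMap_apply]
  congr 1
  ext i
  fin_cases i <;> rfl

theorem bivector_ext {Q Q' : MultiVec T 2} (h : ∀ α β, Q ![α, β] = Q' ![α, β]) : Q = Q' := by
  ext a
  have : a = ![a 0, a 1] := by
    ext i
    fin_cases i <;> rfl
  rw [this, h]

theorem form_ext {η η' : Form T 2} (h : ∀ u v, η ![u, v] = η' ![u, v]) : η = η' := by
  ext a
  have : a = ![a 0, a 1] := by
    ext i
    fin_cases i <;> rfl
  rw [this, h]

theorem sharp_eq [FiniteDimensional ℝ T] {Q : MultiVec T 2} {α : Dual ℝ T} {v : T}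
    (h : ∀ β, Q ![α, β] = β v) : sharp Q α = v := by
  have key : ∀ β : Dual ℝ T, β (sharp Q α - v) = 0 := fun β => by
    rw [map_sub, apply_sharp, h, sub_self]
  exact sub_eq_zero.1 ((Module.forall_dual_apply_eq_zero_iff ℝ _).1 key)

/-- In a plane, a pair of vectors dual to a pair of covectors is a basis. -/
theorem eq_combination_of_dual [FiniteDimensional ℝ T] (hT : finrank ℝ T = 2) {y₀ y₁ : Dual ℝ T}
    {w₀ w₁ : T} (h00 : y₀ w₀ = 1) (h01 : y₀ w₁ = 0) (h10 : y₁ w₀ = 0) (h11 : y₁ w₁ = 1) (v : T) :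
    v = y₀ v • w₀ + y₁ v • w₁ := by
  let L : T →ₗ[ℝ] ℝ × ℝ := y₀.prod y₁
  have hsurj : Function.Surjective L := fun ⟨a, b⟩ => ⟨a • w₀ + b • w₁, by
    simp [L, h00, h01, h10, h11]⟩
  have hinj : Function.Injective L := by
    refine (LinearMap.injective_iff_surjective_of_finrank_eq_finrank ?_).2 hsurj
    rw [hT]
    simp
  apply hinj
  simp [L, h00, h01, h10, h11]

end Pairs

/-! ### The tensor `Π` at a point, in a horizontal frame -/

section TwoThreePointwise

variable {M B : Type*}
  [TopologicalSpace M] [ChartedSpace (EuclideanSpace ℝ (Fin 5)) M]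
  [TopologicalSpace B] [ChartedSpace (EuclideanSpace ℝ (Fin 2)) B]
  {π : M → B} {Ω : ∀ p : M, Form (Tan 5 p) 5} {ωB : ∀ b : B, Form (Tan 2 b) 2}
  {γ : ∀ p : M, Tan 5 p →ₗ[ℝ] Tan 5 p} {κ : M → ℝ} {β : ∀ p : M, Dual ℝ (Tan 5 p)} {p : M}

instance instT2SpaceTangentSpace {n : ℕ} {M : Type*} [TopologicalSpace M]
    [ChartedSpace (EuclideanSpace ℝ (Fin n)) M] (p : M) : T2Space (TangentSpace (𝓡 n) p) :=
  inferInstanceAs (T2Space (EuclideanSpace ℝ (Fin n)))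

theorem finrank_tan (n : ℕ) {M : Type*} [TopologicalSpace M]
    [ChartedSpace (EuclideanSpace ℝ (Fin n)) M] (p : M) : finrank ℝ (Tan n p) = n :=
  finrank_euclideanSpace_fin (𝕜 := ℝ) (n := n)

/-- The basis underlying `tanFrame`. -/
noncomputable def tanBasis (n : ℕ) {M : Type*} [TopologicalSpace M]
    [ChartedSpace (EuclideanSpace ℝ (Fin n)) M] (p : M) : Basis (Fin n) ℝ (Tan n p) :=
  (EuclideanSpace.basisFun (Fin n) ℝ).toBasis

theorem coe_tanBasis (n : ℕ) {M : Type*} [TopologicalSpace M]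
    [ChartedSpace (EuclideanSpace ℝ (Fin n)) M] (p : M) :
    (tanBasis n p : Fin n → Tan n p) = tanFrame p := by
  ext1 i
  exact congrFun (EuclideanSpace.basisFun (Fin n) ℝ).coe_toBasis i

theorem form_basis_ne_zero {T : Type*} [AddCommGroup T] [Module ℝ T] {k : ℕ} {η : Form T k}
    (hη : η ≠ 0) (b : Basis (Fin k) ℝ T) : η b ≠ 0 := fun h => by
  rw [η.eq_smul_basis_det b, h, zero_smul] at hη
  exact hη rfl

theorem form_tanFrame_ne_zero {n : ℕ} {M : Type*} [TopologicalSpace M]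
    [ChartedSpace (EuclideanSpace ℝ (Fin n)) M] {p : M} {η : Form (Tan n p) n} (hη : η ≠ 0) :
    η (tanFrame p) ≠ 0 := by
  rw [← coe_tanBasis]
  exact form_basis_ne_zero hη _

/-- A frame `X₀, X₁` of the horizontal space at `p`, dual to a pair of covectors of the base. -/
structure IsHorizontalFrameAt (π : M → B) (γ : ∀ p : M, Tan 5 p →ₗ[ℝ] Tan 5 p) (p : M)
    (y₀ y₁ : Dual ℝ (Tan 2 (π p))) (X₀ X₁ : Tan 5 p) : Prop where
  mem_vert : ∀ v, γ p v ∈ vert (m := 5) (n := 2) π p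
  eq_self : ∀ v ∈ vert (m := 5) (n := 2) π p, γ p v = v
  horizontal_fst : γ p X₀ = 0
  horizontal_snd : γ p X₁ = 0
  fst_fst : y₀ (dProj (m := 5) (n := 2) π p X₀) = 1
  fst_snd : y₀ (dProj (m := 5) (n := 2) π p X₁) = 0
  snd_fst : y₁ (dProj (m := 5) (n := 2) π p X₀) = 0
  snd_snd : y₁ (dProj (m := 5) (n := 2) π p X₁) = 1

namespace IsHorizontalFrameAt

variable {y₀ y₁ : Dual ℝ (Tan 2 (π p))} {X₀ X₁ : Tan 5 p}

theorem base_eq (h : IsHorizontalFrameAt π γ p y₀ y₁ X₀ X₁) (v : Tan 2 (π p)) :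
    v = y₀ v • dProj (m := 5) (n := 2) π p X₀ + y₁ v • dProj (m := 5) (n := 2) π p X₁ :=
  eq_combination_of_dual (finrank_tan 2 _) h.fst_fst h.fst_snd h.snd_fst h.snd_snd v

/-- Subtracting the horizontal combination with the same projection leaves a vertical vector, which
`γ` fixes. -/
theorem eq_add (h : IsHorizontalFrameAt π γ p y₀ y₁ X₀ X₁) (v : Tan 5 p) :
    v = γ p v + (y₀ (dProj (m := 5) (n := 2) π p v) • X₀ +
      y₁ (dProj (m := 5) (n := 2) π p v) • X₁) := by
  have hv : v - (y₀ (dProj (m := 5) (n := 2) π p v) • X₀ +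
      y₁ (dProj (m := 5) (n := 2) π p v) • X₁) ∈ vert (m := 5) (n := 2) π p := by
    change dProj (m := 5) (n := 2) π p _ = 0
    rw [map_sub, map_add, map_smul, map_smul, ← h.base_eq, sub_self]
  have := h.eq_self _ hv
  rw [map_sub, map_add, map_smul, map_smul, h.horizontal_fst, h.horizontal_snd] at this
  simp only [smul_zero, add_zero, sub_zero] at this
  rw [this, sub_add_cancel]

theorem surjective (h : IsHorizontalFrameAt π γ p y₀ y₁ X₀ X₁) :
    Function.Surjective (dProj (m := 5) (n := 2) π p) := fun v =>
  ⟨y₀ v • X₀ + y₁ v • X₁, by rw [map_add, map_smul, map_smul, ← h.base_eq]⟩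

/-- `ContinuousLinearMap.inverse` takes the default value zero on non-invertible maps, so a
two-sided inverse `s` is exhibited. -/
theorem horLift_apply (h : IsHorizontalFrameAt π γ p y₀ y₁ X₀ X₁) (v : Tan 2 (π p)) :
    horLift π γ p v = y₀ v • X₀ + y₁ v • X₁ := by
  let s : Tan 2 (π p) →ₗ[ℝ] hor γ p :=
    y₀.smulRight ⟨X₀, h.horizontal_fst⟩ + y₁.smulRight ⟨X₁, h.horizontal_snd⟩
  have hs : ∀ u, (s u : Tan 5 p) = y₀ u • X₀ + y₁ u • X₁ := fun u => rfl
  have hinv : ContinuousLinearMap.inverse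
      (dProj (m := 5) (n := 2) π p ∘L (hor γ p).subtypeL) = LinearMap.toContinuousLinearMap s := by
    refine ContinuousLinearMap.inverse_eq ?_ ?_
    · ext1 u
      change dProj (m := 5) (n := 2) π p (s u : Tan 5 p) = u
      rw [hs, map_add, map_smul, map_smul, ← h.base_eq]
    · ext1 u
      refine Subtype.ext ?_
      change (s (dProj (m := 5) (n := 2) π p (u : Tan 5 p)) : Tan 5 p) = u
      have hu : γ p (u : Tan 5 p) = 0 := u.2
      have e := h.eq_add u
      rw [hu, zero_add] at e
      rw [hs, ← e]
  rw [horLift, hinv]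
  rfl

theorem area_ne_zero (h : IsHorizontalFrameAt π γ p y₀ y₁ X₀ X₁) (hω : ωB (π p) ≠ 0) :
    ωB (π p) ![dProj (m := 5) (n := 2) π p X₀, dProj (m := 5) (n := 2) π p X₁] ≠ 0 := fun h0 => by
  refine hω (form_ext fun u v => ?_)
  rw [h.base_eq u, h.base_eq v, form_combination, h0, mul_zero]
  rfl

theorem area_eq (h : IsHorizontalFrameAt π γ p y₀ y₁ X₀ X₁) (u v : Tan 2 (π p)) :
    ωB (π p) ![u, v] = (y₀ u * y₁ v - y₁ u * y₀ v) *
      ωB (π p) ![dProj (m := 5) (n := 2) π p X₀, dProj (m := 5) (n := 2) π p X₁] := by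
  conv_lhs => rw [h.base_eq u, h.base_eq v]
  rw [form_combination]

/-- Passing from `tanFrame` to the frame `dπ X₀, dπ X₁` multiplies the bivector and the value of
`ωB` by the same determinant, so their quotient is frame-independent. -/
theorem push_baseBivector (h : IsHorizontalFrameAt π γ p y₀ y₁ X₀ X₁) (hω : ωB (π p) ≠ 0)
    (α β : Dual ℝ (Tan 5 p)) :
    pushMultiVec (horLift (n := 2) π γ p) (baseBivector ωB (π p)) ![α, β] =
      (ωB (π p) ![dProj (m := 5) (n := 2) π p X₀, dProj (m := 5) (n := 2) π p X₁])⁻¹ *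
        (α X₀ * β X₁ - α X₁ * β X₀) := by
  have h1 := form_tanFrame_ne_zero hω
  have h2 := h.area_ne_zero hω
  have h3 : tanFrame (π p) = ![tanFrame (π p) 0, tanFrame (π p) 1] := by
    ext1 i
    fin_cases i <;> rfl
  have h4 : ωB (π p) (tanFrame (π p)) = _ := (congrArg _ h3).trans (h.area_eq _ _)
  rw [pushMultiVec_pair, baseBivector, AlternatingMap.smul_apply, vecWedge_pair, smul_eq_mul]
  simp only [LinearMap.comp_apply, h.horLift_apply, map_add, map_smul, smul_eq_mul]
  rw [inv_mul_eq_iff_eq_mul₀ h1, h4]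
  field_simp
  ring

theorem finrank_vert (h : IsHorizontalFrameAt π γ p y₀ y₁ X₀ X₁) :
    finrank ℝ (vert (m := 5) (n := 2) π p) = 3 := by
  have h1 := (dProj (m := 5) (n := 2) π p).toLinearMap.finrank_range_add_finrank_ker
  rw [LinearMap.range_eq_top.2 h.surjective, finrank_top, finrank_tan, finrank_tan] at h1
  change 2 + finrank ℝ (vert (m := 5) (n := 2) π p) = 5 at h1
  omega

theorem finrank_hor (h : IsHorizontalFrameAt π γ p y₀ y₁ X₀ X₁) : finrank ℝ (hor γ p) = 2 := by
  have h1 := (γ p).finrank_range_add_finrank_ker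
  have h2 : LinearMap.range (γ p) = vert (m := 5) (n := 2) π p := by
    refine le_antisymm ?_ fun v hv => ⟨v, h.eq_self v hv⟩
    rintro _ ⟨v, rfl⟩
    exact h.mem_vert v
  rw [h2, h.finrank_vert, finrank_tan] at h1
  change 3 + finrank ℝ (hor γ p) = 5 at h1
  omega

theorem vertFrame_spec (h : IsHorizontalFrameAt π γ p y₀ y₁ X₀ X₁) :
    LinearIndependent ℝ (vertFrame π p) ∧
      Submodule.span ℝ (range (vertFrame π p)) = vert (m := 5) (n := 2) π p := by
  refine Classical.epsilon_spec (p := fun v : Fin 3 → Tan 5 p =>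
    LinearIndependent ℝ v ∧ Submodule.span ℝ (range v) = vert (m := 5) (n := 2) π p) ?_
  let b := finBasisOfFinrankEq ℝ _ h.finrank_vert
  refine ⟨fun i => (b i : Tan 5 p), ?_, ?_⟩
  · exact b.linearIndependent.map' (Submodule.subtype _) (Submodule.ker_subtype _)
  · have : range (fun i => (b i : Tan 5 p)) = Submodule.subtype _ '' range b := by
      rw [← range_comp]
      rfl
    rw [this, Submodule.span_image, b.span_eq, Submodule.map_subtype_top]

theorem vertFrame_mem (h : IsHorizontalFrameAt π γ p y₀ y₁ X₀ X₁) (i : Fin 3) :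
    vertFrame π p i ∈ vert (m := 5) (n := 2) π p := by
  rw [← h.vertFrame_spec.2]
  exact Submodule.subset_span ⟨i, rfl⟩

theorem liesIn_vertBivector (h : IsHorizontalFrameAt π γ p y₀ y₁ X₀ X₁) :
    (vertBivector π Ω ωB γ β p).LiesIn (vert (m := 5) (n := 2) π p) := by
  rintro a ⟨i, hi⟩
  have : vecWedge (vertFrame π p) (Matrix.vecCons (β p) a) = 0 := by
    rw [vecWedge_apply]
    -- The covector `β p` occupies row `0`, which shifts the arguments by one.
    refine Matrix.det_eq_zero_of_row_eq_zero i.succ fun j => ?_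
    exact (Submodule.mem_dualAnnihilator _).1 hi _ (h.vertFrame_mem j)
  rw [vertBivector, AlternatingMap.neg_apply, contractCov, AlternatingMap.curryLeft_apply_apply,
    vertTrivector, AlternatingMap.smul_apply, this, smul_zero, neg_zero]

theorem vertBivector_eq_zero (h : IsHorizontalFrameAt π γ p y₀ y₁ X₀ X₁) {α : Dual ℝ (Tan 5 p)}
    (hα : α ∈ (vert (m := 5) (n := 2) π p).dualAnnihilator) (α' : Dual ℝ (Tan 5 p)) :
    vertBivector π Ω ωB γ β p ![α, α'] = 0 := h.liesIn_vertBivector _ ⟨0, hα⟩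

theorem tripleBivector_apply (h : IsHorizontalFrameAt π γ p y₀ y₁ X₀ X₁) (hω : ωB (π p) ≠ 0)
    (α α' : Dual ℝ (Tan 5 p)) :
    tripleBivector π Ω ωB γ κ β p ![α, α'] =
      κ p * (ωB (π p) ![dProj (m := 5) (n := 2) π p X₀, dProj (m := 5) (n := 2) π p X₁])⁻¹ *
        (α X₀ * α' X₁ - α X₁ * α' X₀) + vertBivector π Ω ωB γ β p ![α, α'] := by
  rw [tripleBivector, AlternatingMap.add_apply, AlternatingMap.smul_apply,
    h.push_baseBivector hω, smul_eq_mul, mul_assoc]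

theorem comp_sub_mem (h : IsHorizontalFrameAt π γ p y₀ y₁ X₀ X₁) (α : Dual ℝ (Tan 5 p)) :
    α ∘ₗ (LinearMap.id - γ p) ∈ (vert (m := 5) (n := 2) π p).dualAnnihilator := by
  refine (Submodule.mem_dualAnnihilator _).2 fun v hv => ?_
  simp [h.eq_self v hv]

theorem comp20_apply (h : IsHorizontalFrameAt π γ p y₀ y₁ X₀ X₁) (hω : ωB (π p) ≠ 0)
    (α α' : Dual ℝ (Tan 5 p)) :
    comp20 γ (tripleBivector π Ω ωB γ κ β) p ![α, α'] =
      κ p * (ωB (π p) ![dProj (m := 5) (n := 2) π p X₀, dProj (m := 5) (n := 2) π p X₁])⁻¹ *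
        (α X₀ * α' X₁ - α X₁ * α' X₀) := by
  rw [comp20, pushMultiVec_pair, h.tripleBivector_apply hω,
    h.vertBivector_eq_zero (h.comp_sub_mem α)]
  simp [h.horizontal_fst, h.horizontal_snd]

theorem comp02_eq (h : IsHorizontalFrameAt π γ p y₀ y₁ X₀ X₁) (hω : ωB (π p) ≠ 0) :
    vertBivector π Ω ωB γ β p = comp02 γ (tripleBivector π Ω ωB γ κ β) p := by
  refine bivector_ext fun α α' => ?_
  -- `α` and `α ∘ γ` differ by a covector that annihilates `𝕍`, hence is a Casimir.
  have key : ∀ α α', vertBivector π Ω ωB γ β p ![α ∘ₗ γ p, α'] =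
      vertBivector π Ω ωB γ β p ![α, α'] := fun α α' => by
    have e : α ∘ₗ γ p = α - α ∘ₗ (LinearMap.id - γ p) := by
      ext v
      simp
    rw [e, bivector_sub_left, h.vertBivector_eq_zero (h.comp_sub_mem α), sub_zero]
  rw [comp02, pushMultiVec_pair, h.tripleBivector_apply hω, key, bivector_swap _ α (α' ∘ₗ γ p),
    key, bivector_swap _ α' α]
  simp [h.horizontal_fst, h.horizontal_snd]

theorem sharp_comp20 (h : IsHorizontalFrameAt π γ p y₀ y₁ X₀ X₁) (hω : ωB (π p) ≠ 0)
    (α : Dual ℝ (Tan 5 p)) : sharp (comp20 γ (tripleBivector π Ω ωB γ κ β) p) α =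
      (κ p * (ωB (π p) ![dProj (m := 5) (n := 2) π p X₀, dProj (m := 5) (n := 2) π p X₁])⁻¹) •
        (α X₀ • X₁ - α X₁ • X₀) :=
  sharp_eq fun α' => by
    rw [h.comp20_apply hω]
    simp

theorem sharp_tripleBivector (h : IsHorizontalFrameAt π γ p y₀ y₁ X₀ X₁) (hω : ωB (π p) ≠ 0)
    {α : Dual ℝ (Tan 5 p)} (hα : α ∈ (vert (m := 5) (n := 2) π p).dualAnnihilator) :
    sharp (tripleBivector π Ω ωB γ κ β p) α =
      (κ p * (ωB (π p) ![dProj (m := 5) (n := 2) π p X₀, dProj (m := 5) (n := 2) π p X₁])⁻¹) •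
        (α X₀ • X₁ - α X₁ • X₀) :=
  sharp_eq fun α' => by
    rw [h.tripleBivector_apply hω, h.vertBivector_eq_zero hα]
    simp

theorem comp_dProj_mem (y : Dual ℝ (Tan 2 (π p))) :
    y ∘ₗ (dProj (m := 5) (n := 2) π p).toLinearMap ∈
      (vert (m := 5) (n := 2) π p).dualAnnihilator := by
  refine (Submodule.mem_dualAnnihilator _).2 fun v hv => ?_
  have : dProj (m := 5) (n := 2) π p v = 0 := hv
  simp [this]

theorem sharpAnnVert_eq (h : IsHorizontalFrameAt π γ p y₀ y₁ X₀ X₁) (hω : ωB (π p) ≠ 0)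
    (hκ : κ p ≠ 0) :
    sharpAnnVert (m := 5) (n := 2) π (tripleBivector π Ω ωB γ κ β) p = hor γ p := by
  have hc := mul_ne_zero hκ (inv_ne_zero (h.area_ne_zero hω))
  set c := κ p *
    (ωB (π p) ![dProj (m := 5) (n := 2) π p X₀, dProj (m := 5) (n := 2) π p X₁])⁻¹ with hcdef
  refine le_antisymm ?_ fun v hv => ?_
  · rintro _ ⟨α, hα, rfl⟩
    change γ p _ = 0
    rw [h.sharp_tripleBivector hω hα]
    simp [h.horizontal_fst, h.horizontal_snd]
  -- The covector is found by solving `c (z(dπ X₀) X₁ - z(dπ X₁) X₀) = v`, using the coordinates of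
  -- the horizontal vector `v`.
  · let z : Dual ℝ (Tan 2 (π p)) := (c⁻¹ * y₁ (dProj (m := 5) (n := 2) π p v)) • y₀ -
      (c⁻¹ * y₀ (dProj (m := 5) (n := 2) π p v)) • y₁
    refine ⟨z ∘ₗ (dProj (m := 5) (n := 2) π p).toLinearMap, comp_dProj_mem z, ?_⟩
    rw [h.sharp_tripleBivector hω (comp_dProj_mem z), ← hcdef]
    have hv' : γ p v = 0 := hv
    have e := h.eq_add v
    rw [hv', zero_add] at e
    conv_rhs => rw [e]
    simp only [z, LinearMap.comp_apply, LinearMap.sub_apply, LinearMap.smul_apply,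
      ContinuousLinearMap.coe_coe, h.fst_fst, h.fst_snd, h.snd_fst, h.snd_snd, smul_eq_mul,
      mul_one, mul_zero, sub_zero, zero_sub, neg_smul, sub_neg_eq_add]
    rw [smul_add, smul_smul, smul_smul, mul_inv_cancel_left₀ hc, mul_inv_cancel_left₀ hc, add_comm]

/-- `Π_{2,0}` is a multiple of `X₀ ∧ X₁`, with factor zero exactly when `κ p = 0`; its sharp map has
range zero or the whole horizontal plane. -/
theorem mem_couplingDomain_iff (h : IsHorizontalFrameAt π γ p y₀ y₁ X₀ X₁) (hω : ωB (π p) ≠ 0) :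
    p ∈ couplingDomain 2 γ (tripleBivector π Ω ωB γ κ β) ↔ κ p ≠ 0 := by
  change finrank ℝ (LinearMap.range (sharp (comp20 γ (tripleBivector π Ω ωB γ κ β) p))) = 2 ↔ _
  constructor
  · intro h2 hκ
    have : sharp (comp20 γ (tripleBivector π Ω ωB γ κ β) p) = 0 := by
      ext1 α
      rw [h.sharp_comp20 hω, hκ]
      simp
    rw [this, LinearMap.range_zero, finrank_bot] at h2
    omega
  · intro hκ
    have : LinearMap.range (sharp (comp20 γ (tripleBivector π Ω ωB γ κ β) p)) = hor γ p := by
      refine le_antisymm ?_ ?_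
      · rintro _ ⟨α, rfl⟩
        change γ p _ = 0
        rw [h.sharp_comp20 hω]
        simp [h.horizontal_fst, h.horizontal_snd]
      · rw [← h.sharpAnnVert_eq (Ω := Ω) (β := β) hω hκ]
        rintro _ ⟨α, hα, rfl⟩
        exact ⟨α, by rw [h.sharp_comp20 hω, h.sharp_tripleBivector hω hα]⟩
    rw [this, h.finrank_hor]

/-- Since `α` kills `𝕍`, it is determined by `α X₀` and `α X₁`; the factor `κ / w` of `Π_{2,0}`
cancels the factor `w / κ` of the form. -/
theorem coupling_form_eq (h : IsHorizontalFrameAt π γ p y₀ y₁ X₀ X₁) (hω : ωB (π p) ≠ 0)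
    (hκ : κ p ≠ 0) {α : Dual ℝ (Tan 5 p)}
    (hα : α ∈ (vert (m := 5) (n := 2) π p).dualAnnihilator) (v : Tan 5 p) :
    contractVec (sharp (comp20 γ (tripleBivector π Ω ωB γ κ β) p) α)
      ((κ p)⁻¹ • pullForm π ωB p) ![v] = -α v := by
  have hw := h.area_ne_zero hω
  have hαγ : α (γ p v) = 0 := (Submodule.mem_dualAnnihilator _).1 hα _ (h.mem_vert v)
  have hv : α v = y₀ (dProj (m := 5) (n := 2) π p v) * α X₀ +
      y₁ (dProj (m := 5) (n := 2) π p v) * α X₁ := by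
    conv_lhs => rw [h.eq_add v]
    simp [hαγ]
  have hpull : ∀ u : Tan 5 p, contractVec u ((κ p)⁻¹ • pullForm π ωB p) ![v] =
      (κ p)⁻¹ * ωB (π p) ![dProj (m := 5) (n := 2) π p u, dProj (m := 5) (n := 2) π p v] := by
    intro u
    rw [contractVec, AlternatingMap.curryLeft_apply_apply, AlternatingMap.smul_apply, pullForm,
      AlternatingMap.compLinearMap_apply, smul_eq_mul]
    congr 2
    ext1 i
    fin_cases i <;> rfl
  rw [hpull, h.sharp_comp20 hω, h.area_eq, hv]
  simp only [map_smul, map_sub, h.fst_fst, h.fst_snd, h.snd_fst, h.snd_snd, smul_eq_mul]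
  field_simp
  ring

end IsHorizontalFrameAt

end TwoThreePointwise

/-! ### Nondegeneracy of the vertical volume and the kernel of `P_β` -/

section Volume

variable {M B : Type*}
  [TopologicalSpace M] [ChartedSpace (EuclideanSpace ℝ (Fin 5)) M]
  [TopologicalSpace B] [ChartedSpace (EuclideanSpace ℝ (Fin 2)) B]
  {π : M → B} {Ω : ∀ p : M, Form (Tan 5 p) 5} {ωB : ∀ b : B, Form (Tan 2 b) 2}
  {γ : ∀ p : M, Tan 5 p →ₗ[ℝ] Tan 5 p} {κ : M → ℝ} {β : ∀ p : M, Dual ℝ (Tan 5 p)} {p : M}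

namespace IsHorizontalFrameAt

variable {y₀ y₁ : Dual ℝ (Tan 2 (π p))} {X₀ X₁ : Tan 5 p}

theorem dProj_horLift (h : IsHorizontalFrameAt π γ p y₀ y₁ X₀ X₁) (v : Tan 2 (π p)) :
    dProj (m := 5) (n := 2) π p (horLift π γ p v) = v := by
  rw [h.horLift_apply, map_add, map_smul, map_smul, ← h.base_eq]

/-- Horizontal lifts of a base frame and a vertical frame together form a basis. -/
theorem linearIndependent_frame (h : IsHorizontalFrameAt π γ p y₀ y₁ X₀ X₁) {v : Fin 3 → Tan 5 p}
    (hv : LinearIndependent ℝ v) (hvert : ∀ i, v i ∈ vert (m := 5) (n := 2) π p) :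
    LinearIndependent ℝ (Matrix.vecCons (horLift (n := 2) π γ p (tanFrame (π p) 0))
      (Matrix.vecCons (horLift (n := 2) π γ p (tanFrame (π p) 1)) v)) := by
  have hd : ∀ i, dProj (m := 5) (n := 2) π p (v i) = 0 := hvert
  have hc : ∀ i j, (tanBasis 2 (π p)).coord i (tanFrame (π p) j) = if j = i then 1 else 0 := by
    intro i j
    rw [← coe_tanBasis, Basis.coord_apply, Basis.repr_self_apply]
  -- The base coordinate `1` of `dπ` separates the second lift from the vertical vectors; coordinate
  -- `0` separates the first lift from all the others.
  have key : ∀ (s : Set (Tan 5 p)) (i : Fin 2) (u : Tan 5 p), u ∈ Submodule.span ℝ s →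
      (∀ w ∈ s, (tanBasis 2 (π p)).coord i (dProj (m := 5) (n := 2) π p w) = 0) →
      (tanBasis 2 (π p)).coord i (dProj (m := 5) (n := 2) π p u) = 0 := by
    intro s i u hu hs
    have : Submodule.span ℝ s ≤ LinearMap.ker
        ((tanBasis 2 (π p)).coord i ∘ₗ (dProj (m := 5) (n := 2) π p).toLinearMap) :=
      Submodule.span_le.2 hs
    exact this hu
  refine (linearIndependent_finCons (x := horLift (n := 2) π γ p (tanFrame (π p) 0))).2
    ⟨(linearIndependent_finCons (x := horLift (n := 2) π γ p (tanFrame (π p) 1))).2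
      ⟨hv, fun hmem => ?_⟩, fun hmem => ?_⟩
  · have := key _ 1 _ hmem (by
      rintro _ ⟨i, rfl⟩
      rw [hd, map_zero])
    rw [h.dProj_horLift, hc] at this
    simp at this
  · have := key _ 0 _ hmem (by
      rintro _ ⟨i, rfl⟩
      refine Fin.cases ?_ (fun i => ?_) i
      · rw [Matrix.cons_val_zero, h.dProj_horLift, hc]
        simp
      · rw [Matrix.cons_val_succ, hd, map_zero])
    rw [h.dProj_horLift, hc] at this
    simp at this

/-- Up to a nonzero factor this is `Ω` evaluated on the basis of `linearIndependent_frame`. -/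
theorem vertVolume_ne_zero (h : IsHorizontalFrameAt π γ p y₀ y₁ X₀ X₁) (hΩ : Ω p ≠ 0)
    (hω : ωB (π p) ≠ 0) {v : Fin 3 → Tan 5 p} (hv : LinearIndependent ℝ v)
    (hvert : ∀ i, v i ∈ vert (m := 5) (n := 2) π p) : vertVolume π Ω ωB γ p v ≠ 0 := by
  have hli := h.linearIndependent_frame hv hvert
  have hb := form_basis_ne_zero hΩ (basisOfLinearIndependentOfCardEqFinrank hli
    (by rw [finrank_tan, Fintype.card_fin]))
  rw [coe_basisOfLinearIndependentOfCardEqFinrank] at hb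
  have hγ : (fun i => γ p (v i)) = v := funext fun i => h.eq_self _ (hvert i)
  rw [vertVolume, AlternatingMap.smul_apply, AlternatingMap.compLinearMap_apply]
  refine smul_ne_zero (inv_ne_zero (form_tanFrame_ne_zero hω)) ?_
  rw [contractVec, AlternatingMap.curryLeft_apply_apply, contractVec,
    AlternatingMap.curryLeft_apply_apply, hγ]
  exact hb

/-- If `P_β(α, ·) = 0` then `(α ∘ γ) ∧ β = 0`. -/
theorem covWedge_eq_zero (h : IsHorizontalFrameAt π γ p y₀ y₁ X₀ X₁) (hΩ : Ω p ≠ 0)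
    (hω : ωB (π p) ≠ 0) (hβ : β p ∈ (hor γ p).dualAnnihilator) {α : Dual ℝ (Tan 5 p)}
    (hα : ∀ α', vertBivector π Ω ωB γ β p ![α, α'] = 0) : covWedge ![α ∘ₗ γ p, β p] = 0 := by
  obtain ⟨hli, hspan⟩ := h.vertFrame_spec
  have hvol : vertVolume π Ω ωB γ p ![vertFrame π p 2, vertFrame π p 1, vertFrame π p 0] ≠ 0 := by
    -- The reversed order comes from the convention for contracting with a trivector; it does not
    -- affect linear independence.
    have e : ![vertFrame π p 2, vertFrame π p 1, vertFrame π p 0] = vertFrame π p ∘ Fin.rev := by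
      ext1 i
      fin_cases i <;> rfl
    rw [e]
    exact h.vertVolume_ne_zero hΩ hω (hli.comp _ Fin.rev_injective) fun i => h.vertFrame_mem _
  set v := vertFrame π p
  have hdet : ∀ α' : Dual ℝ (Tan 5 p), vecWedge v ![β p, α, α'] = 0 := fun α' => by
    have := hα α'
    rw [vertBivector, AlternatingMap.neg_apply, contractCov, AlternatingMap.curryLeft_apply_apply,
      vertTrivector, AlternatingMap.smul_apply, neg_eq_zero] at this
    exact (smul_eq_zero.1 this).resolve_left (inv_ne_zero hvol)
  have hdual : ∀ i : Fin 3, ∃ α' : Dual ℝ (Tan 5 p), ∀ j, α' (v j) = if i = j then 1 else 0 := by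
    intro i
    obtain ⟨a, ha⟩ := LinearMap.exists_extend ((Basis.span hli).coord i)
    refine ⟨a, fun j => ?_⟩
    have h1 : ((Basis.span hli j : Submodule.span ℝ (range v)) : Tan 5 p) = v j :=
      congrArg Subtype.val (Basis.span_apply hli j)
    have h2 : (Basis.span hli).coord i (Basis.span hli j) = if i = j then 1 else 0 := by
      rw [Basis.coord_apply, Basis.repr_self_apply]
      simp only [eq_comm]
    rw [← h1, ← h2]
    exact LinearMap.congr_fun ha (Basis.span hli j)
  -- Taking `α'` in the basis dual to `v` expands the determinant into a two-by-two minor of `(β,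
  -- α)`, so all these minors vanish.
  have minor : ∀ i j, β p (v i) * α (v j) - β p (v j) * α (v i) = 0 := by
    obtain ⟨a0, h0⟩ := hdual 0
    obtain ⟨a1, h1⟩ := hdual 1
    obtain ⟨a2, h2⟩ := hdual 2
    have e0 := hdet a0
    have e1 := hdet a1
    have e2 := hdet a2
    simp only [vecWedge_apply, Matrix.det_fin_three, Matrix.of_apply, Matrix.cons_val, h0, h1, h2,
      Fin.isValue, reduceIte, Fin.reduceEq] at e0 e1 e2
    intro i j
    fin_cases i <;> fin_cases j <;>
      simp only [Fin.reduceFinMk, Fin.mk_one, Fin.zero_eta, Fin.isValue] <;> linarith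
  have hcomb : ∀ u ∈ vert (m := 5) (n := 2) π p, ∃ c : Fin 3 → ℝ, ∑ i, c i • v i = u := by
    intro u hu
    rw [← hspan] at hu
    exact (Submodule.mem_span_range_iff_exists_fun ℝ).1 hu
  refine form_ext fun u u' => ?_
  -- As `β` kills `ℍ`, both covectors factor through `γ`, and only vertical arguments matter.
  have hβγ : ∀ u, β p u = β p (γ p u) := fun u => by
    have : u - γ p u ∈ hor γ p := by
      change γ p _ = 0
      rw [map_sub, h.eq_self _ (h.mem_vert u), sub_self]
    have := (Submodule.mem_dualAnnihilator _).1 hβ _ this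
    rw [map_sub] at this
    linarith
  rw [covWedge_pair]
  simp only [Matrix.cons_val_zero, Matrix.cons_val_one, LinearMap.comp_apply,
    AlternatingMap.zero_apply]
  rw [hβγ u, hβγ u']
  obtain ⟨c, hc⟩ := hcomb _ (h.mem_vert u)
  obtain ⟨d, hd⟩ := hcomb _ (h.mem_vert u')
  rw [← hc, ← hd]
  simp only [Fin.sum_univ_three, map_add, map_smul, smul_eq_mul]
  -- The Cauchy–Binet expansion of the wedge on two combinations of `v`.
  linear_combination -(c 0 * d 1 - c 1 * d 0) * minor 0 1 - (c 0 * d 2 - c 2 * d 0) * minor 0 2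
    - (c 1 * d 2 - c 2 * d 1) * minor 1 2

end IsHorizontalFrameAt

end Volume

/-! ### Submersions and functions pulled back from the base -/

section Submersion

variable {m n : ℕ} {M B : Type*}
  [TopologicalSpace M] [ChartedSpace (EuclideanSpace ℝ (Fin m)) M]
  [TopologicalSpace B] [ChartedSpace (EuclideanSpace ℝ (Fin n)) B]

theorem mdifferentiable_of_mem_maximalAtlas [IsManifold (𝓡 n) ∞ B]
    {e : OpenPartialHomeomorph B (EuclideanSpace ℝ (Fin n))}
    (he : e ∈ IsManifold.maximalAtlas (𝓡 n) ∞ B) : e.MDifferentiable (𝓡 n) (𝓡 n) :=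
  ⟨(contMDiffOn_of_mem_maximalAtlas he).mdifferentiableOn (by simp),
    (contMDiffOn_symm_of_mem_maximalAtlas he).mdifferentiableOn (by simp)⟩

/-- Differentiate `ψ ∘ π = L ∘ φ` at `p`: `dφ` and `L` are surjective and `dψ` is injective, so
preimages under `L ∘ dφ` are preimages under `dπ`. -/
theorem dProj_surjective_of_eqOn [IsManifold (𝓡 m) ∞ M] [IsManifold (𝓡 n) ∞ B] {π : M → B}
    {φ : OpenPartialHomeomorph M (EuclideanSpace ℝ (Fin m))}
    {ψ : OpenPartialHomeomorph B (EuclideanSpace ℝ (Fin n))}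
    (hφ : φ.MDifferentiable (𝓡 m) (𝓡 m)) (hψ : ψ.MDifferentiable (𝓡 n) (𝓡 n))
    {L : EuclideanSpace ℝ (Fin m) →L[ℝ] EuclideanSpace ℝ (Fin n)} (hL : Function.Surjective L)
    (heq : ∀ q ∈ φ.source, ψ (π q) = L (φ q)) {p : M} (hp : p ∈ φ.source) (hp' : π p ∈ ψ.source)
    (hd : MDifferentiableAt (𝓡 m) (𝓡 n) π p) :
    Function.Surjective (dProj (m := m) (n := n) π p) := by
  have hev : (ψ ∘ π) =ᶠ[nhds p] (L ∘ φ) :=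
    Filter.eventuallyEq_of_mem (φ.open_source.mem_nhds hp) heq
  have e1 : mfderiv (𝓡 m) (𝓡 n) (ψ ∘ π) p =
      (mfderiv (𝓡 n) (𝓡 n) ψ (π p)).comp (mfderiv (𝓡 m) (𝓡 n) π p) :=
    mfderiv_comp p (hψ.mdifferentiableAt hp') hd
  have e2 : mfderiv (𝓡 m) (𝓡 n) (L ∘ φ) p =
      (mfderiv (𝓡 m) (𝓡 n) L (φ p)).comp (mfderiv (𝓡 m) (𝓡 m) φ p) :=
    mfderiv_comp p L.mdifferentiableAt (hφ.mdifferentiableAt hp)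
  rw [ContinuousLinearMap.mfderiv_eq] at e2
  have e3 := (e1.symm.trans hev.mfderiv_eq).trans e2
  intro v
  obtain ⟨w, hw⟩ := hL (mfderiv (𝓡 n) (𝓡 n) ψ (π p) v)
  obtain ⟨u, hu⟩ := hφ.mfderiv_surjective hp w
  refine ⟨u, hψ.mfderiv_injective hp' ?_⟩
  have e4 : mfderiv (𝓡 n) (𝓡 n) ψ (π p) (mfderiv (𝓡 m) (𝓡 n) π p u) =
      L (mfderiv (𝓡 m) (𝓡 m) φ p u) := congrArg (fun l => l u) e3
  exact e4.trans ((congrArg L hu).trans hw)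

/-- In the adapted charts a submersion is a linear projection onto the first factor, which serves as
`L`. -/
theorem dProj_surjective [IsManifold (𝓡 m) ∞ M] [IsManifold (𝓡 n) ∞ B] {π : M → B}
    (hπ : Manifold.IsSubmersion (𝓡 m) (𝓡 n) ∞ π) (p : M) :
    Function.Surjective (dProj (m := m) (n := n) π p) := by
  have h := hπ.isSubmersionAt p
  refine dProj_surjective_of_eqOn
    (L := (ContinuousLinearMap.fst ℝ _ _).comp h.equiv.toContinuousLinearMap)
    (mdifferentiable_of_mem_maximalAtlas h.domChart_mem_maximalAtlas)
    (mdifferentiable_of_mem_maximalAtlas h.codChart_mem_maximalAtlas)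
    (fun w => ⟨h.equiv.symm (w, 0), ?_⟩) (fun q hq => ?_) h.mem_domChart_source
    h.mem_codChart_source ((hπ.contMDiff p).mdifferentiableAt (by simp))
  · exact congrArg Prod.fst (h.equiv.apply_symm_apply (w, 0))
  · have hw := h.writtenInCharts
    generalize h.domChart = φ at hw hq ⊢
    generalize h.codChart = ψ at hw ⊢
    have h1 := hw ((φ.extend (𝓡 m)).map_source (by rwa [OpenPartialHomeomorph.extend_source]))
    have h2 : (φ.extend (𝓡 m)).symm (φ.extend (𝓡 m) q) = q := φ.extend_left_inv hq
    have h3 : ψ (π ((φ.extend (𝓡 m)).symm (φ.extend (𝓡 m) q))) = (h.equiv (φ q)).1 := h1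
    rw [h2] at h3
    exact h3

theorem SmoothFunOn.comp_proj {π : M → B} {y : B → ℝ} {U : Set B} (hy : SmoothFunOn n y U)
    (hπ : ContMDiff (𝓡 m) (𝓡 n) ∞ π) {V : Set M} (hV : V ⊆ π ⁻¹' U) :
    SmoothFunOn m (fun q => y (π q)) V :=
  ContMDiffOn.comp hy hπ.contMDiffOn hV

theorem dAt_comp_proj {π : M → B} {y : B → ℝ} {U : Set B} (hU : IsOpen U) (hy : SmoothFunOn n y U)
    (hπ : ContMDiff (𝓡 m) (𝓡 n) ∞ π) {q : M} (hq : π q ∈ U) :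
    dAt (n := m) (fun q => y (π q)) q =
      dAt y (π q) ∘ₗ (dProj (m := m) (n := n) π q).toLinearMap := by
  have := mvfderiv_comp q (hy.mdifferentiableAt hU hq)
    ((hπ q).mdifferentiableAt (by simp))
  exact congrArg ContinuousLinearMap.toLinearMap this

end Submersion

/-! ### Local frames dual to functions -/

section DualFrame

variable {n : ℕ} {M : Type*} [TopologicalSpace M] [ChartedSpace (EuclideanSpace ℝ (Fin n)) M]
  [IsManifold (𝓡 n) ∞ M]

/-- Functions with independent differentials at a point admit a dual local frame. -/
theorem exists_dual_frame {x₀ x₁ : M → ℝ} {U : Set M} (hU : IsOpen U) (h₀ : SmoothFunOn n x₀ U)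
    (h₁ : SmoothFunOn n x₁ U) {p : M} (hp : p ∈ U) {v₀ v₁ : Tan n p}
    (h00 : dAt x₀ p v₀ = 1) (h01 : dAt x₀ p v₁ = 0) (h10 : dAt x₁ p v₀ = 0)
    (h11 : dAt x₁ p v₁ = 1) :
    ∃ (V : Set M) (X₀ X₁ : ∀ q : M, Tan n q), IsOpen V ∧ V ⊆ U ∧ p ∈ V ∧ SmoothVecOn X₀ V ∧
      SmoothVecOn X₁ V ∧ ∀ q ∈ V, dAt x₀ q (X₀ q) = 1 ∧ dAt x₀ q (X₁ q) = 0 ∧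
        dAt x₁ q (X₀ q) = 0 ∧ dAt x₁ q (X₁ q) = 1 := by
  obtain ⟨V₀, Z₀, hV₀, hp₀, hZ₀, rfl⟩ := exists_smoothVecOn_eq p v₀
  obtain ⟨V₁, Z₁, hV₁, hp₁, hZ₁, rfl⟩ := exists_smoothVecOn_eq p v₁
  have hW : IsOpen (U ∩ (V₀ ∩ V₁)) := hU.inter (hV₀.inter hV₁)
  set W := U ∩ (V₀ ∩ V₁) with hWdef
  have hpW : p ∈ W := ⟨hp, hp₀, hp₁⟩
  replace h₀ := h₀.mono (inter_subset_left : W ⊆ U)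
  replace h₁ := h₁.mono (inter_subset_left : W ⊆ U)
  replace hZ₀ := hZ₀.mono (fun q hq => hq.2.1 : W ⊆ V₀)
  replace hZ₁ := hZ₁.mono (fun q hq => hq.2.2 : W ⊆ V₁)
  have a00 := h₀.dAt_apply hW hZ₀
  have a01 := h₀.dAt_apply hW hZ₁
  have a10 := h₁.dAt_apply hW hZ₀
  have a11 := h₁.dAt_apply hW hZ₁
  have hD := (a00.mul a11).sub (a01.mul a10)
  -- `D` is the determinant of the matrix `dxᵢ(Zⱼ)`, equal to `1` at `p`. Where it is nonzero,
  -- Cramer's rule turns `Z₀, Z₁` into the dual frame.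
  set D : M → ℝ := fun q => dAt x₀ q (Z₀ q) * dAt x₁ q (Z₁ q) - dAt x₀ q (Z₁ q) * dAt x₁ q (Z₀ q)
    with hDdef
  have hV : IsOpen (W ∩ D ⁻¹' {0}ᶜ) :=
    (ContMDiffOn.continuousOn hD).isOpen_inter_preimage hW isOpen_compl_singleton
  have hVW : W ∩ D ⁻¹' {0}ᶜ ⊆ W := inter_subset_left
  have hDi := (hD.mono hVW).inv fun q hq => hq.2
  refine ⟨W ∩ D ⁻¹' {0}ᶜ,
    fun q => ((D q)⁻¹ * dAt x₁ q (Z₁ q)) • Z₀ q - ((D q)⁻¹ * dAt x₁ q (Z₀ q)) • Z₁ q,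
    fun q => ((D q)⁻¹ * dAt x₀ q (Z₀ q)) • Z₁ q - ((D q)⁻¹ * dAt x₀ q (Z₁ q)) • Z₀ q,
    hV, hVW.trans inter_subset_left, ⟨hpW, ?_⟩, ?_, ?_, fun q hq => ?_⟩
  · simp [hDdef, h00, h01, h11]
  · exact ((hZ₀.mono hVW).smul (hDi.mul (a11.mono hVW))).sub
      ((hZ₁.mono hVW).smul (hDi.mul (a10.mono hVW)))
  · exact ((hZ₁.mono hVW).smul (hDi.mul (a00.mono hVW))).sub
      ((hZ₀.mono hVW).smul (hDi.mul (a01.mono hVW)))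
  · have hq0 : D q ≠ 0 := hq.2
    simp only [map_sub, map_smul, smul_eq_mul, mul_assoc, ← mul_sub]
    refine ⟨?_, ?_, ?_, ?_⟩
    · rw [inv_mul_eq_iff_eq_mul₀ hq0, hDdef]; ring
    · rw [inv_mul_eq_iff_eq_mul₀ hq0]; ring
    · rw [inv_mul_eq_iff_eq_mul₀ hq0]; ring
    · rw [inv_mul_eq_iff_eq_mul₀ hq0, hDdef]; ring

end DualFrame

/-! ### Horizontal frames adapted to base coordinates -/

section AdaptedFrame

variable {M B : Type*}
  [TopologicalSpace M] [ChartedSpace (EuclideanSpace ℝ (Fin 5)) M] [IsManifold (𝓡 5) ∞ M]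
  [TopologicalSpace B] [ChartedSpace (EuclideanSpace ℝ (Fin 2)) B] [IsManifold (𝓡 2) ∞ B]
  {π : M → B} {Ω : ∀ p : M, Form (Tan 5 p) 5} {ωB : ∀ b : B, Form (Tan 2 b) 2}
  {γ : ∀ p : M, Tan 5 p →ₗ[ℝ] Tan 5 p} {κ : M → ℝ} {β : ∀ p : M, Dual ℝ (Tan 5 p)}

/-- On `V`, the fields `X₀, X₁` are smooth and horizontal, and dual to the differentials of the
functions `y₀, y₁`, smooth on the open set `U` of the base; `w = π^*ωB (X₀, X₁)`. -/
structure IsAdaptedFrameOn (π : M → B) (ωB : ∀ b : B, Form (Tan 2 b) 2)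
    (γ : ∀ p : M, Tan 5 p →ₗ[ℝ] Tan 5 p) (y₀ y₁ : B → ℝ)
    (X₀ X₁ : ∀ p : M, Tan 5 p) (U : Set B) (V : Set M) : Prop where
  isOpen_base : IsOpen U
  isOpen : IsOpen V
  mapsTo : V ⊆ π ⁻¹' U
  smooth_fst : SmoothFunOn 2 y₀ U
  smooth_snd : SmoothFunOn 2 y₁ U
  smooth_vec_fst : SmoothVecOn X₀ V
  smooth_vec_snd : SmoothVecOn X₁ V
  frame : ∀ q ∈ V, IsHorizontalFrameAt π γ q (dAt y₀ (π q)) (dAt y₁ (π q)) (X₀ q) (X₁ q)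
  smooth_area : SmoothFunOn 5 (fun q => ωB (π q)
    ![dProj (m := 5) (n := 2) π q (X₀ q), dProj (m := 5) (n := 2) π q (X₁ q)]) V

/-- A frame `Zᵢ` dual to the pulled-back coordinates is made horizontal by subtracting `γ Zᵢ`, which
is vertical and so leaves the projections unchanged. -/
theorem IsFiberedTriple.exists_adaptedFrame (h : IsFiberedTriple π Ω ωB γ κ β) (p : M) :
    ∃ (y₀ y₁ : B → ℝ) (X₀ X₁ : ∀ p : M, Tan 5 p) (U : Set B) (V : Set M),
      IsAdaptedFrameOn π ωB γ y₀ y₁ X₀ X₁ U V ∧ p ∈ V := by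
  have hπ := h.submersion.contMDiff
  have hγv := fun q => h.ehresmann.mem_vert q (mem_univ q)
  have hγs := fun q => h.ehresmann.eq_self q (mem_univ q)
  have hγ := h.ehresmann.smooth
  let b := tanBasis 2 (π p)
  obtain ⟨U₀, y₀, hU₀, hp₀, hy₀, e₀⟩ := exists_dAt_eq (π p) (b.coord 0)
  obtain ⟨U₁, y₁, hU₁, hp₁, hy₁, e₁⟩ := exists_dAt_eq (π p) (b.coord 1)
  have hU' := hU₀.inter hU₁
  have hy₀' := hy₀.mono (inter_subset_left : U₀ ∩ U₁ ⊆ U₀)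
  have hy₁' := hy₁.mono (inter_subset_right : U₀ ∩ U₁ ⊆ U₁)
  obtain ⟨U, E₀, E₁, hU, hUU', hpU, hE₀, hE₁, hE⟩ := exists_dual_frame hU' hy₀' hy₁' ⟨hp₀, hp₁⟩
    (v₀ := b 0) (v₁ := b 1) (by simp [e₀]) (by simp [e₀]) (by simp [e₁]) (by simp [e₁])
  replace hy₀ := hy₀'.mono hUU'
  replace hy₁ := hy₁'.mono hUU'
  have hN : IsOpen (π ⁻¹' U) := hU.preimage hπ.continuous
  have hd := dProj_surjective h.submersion p
  obtain ⟨v₀, hv₀⟩ := hd (b 0)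
  obtain ⟨v₁, hv₁⟩ := hd (b 1)
  have hx₀ := hy₀.comp_proj hπ (subset_rfl : π ⁻¹' U ⊆ π ⁻¹' U)
  have hx₁ := hy₁.comp_proj hπ (subset_rfl : π ⁻¹' U ⊆ π ⁻¹' U)
  have d₀ : ∀ q ∈ π ⁻¹' U, ∀ v, dAt (n := 5) (fun q => y₀ (π q)) q v =
      dAt y₀ (π q) (dProj (m := 5) (n := 2) π q v) := fun q hq v => by
    rw [dAt_comp_proj hU hy₀ hπ hq]; rfl
  have d₁ : ∀ q ∈ π ⁻¹' U, ∀ v, dAt (n := 5) (fun q => y₁ (π q)) q v =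
      dAt y₁ (π q) (dProj (m := 5) (n := 2) π q v) := fun q hq v => by
    rw [dAt_comp_proj hU hy₁ hπ hq]; rfl
  obtain ⟨V, Z₀, Z₁, hV, hVU, hpV, hZ₀, hZ₁, hZ⟩ := exists_dual_frame hN hx₀ hx₁ hpU
    (v₀ := v₀) (v₁ := v₁) (by rw [d₀ p hpU, hv₀, e₀]; simp) (by rw [d₀ p hpU, hv₁, e₀]; simp)
    (by rw [d₁ p hpU, hv₀, e₁]; simp) (by rw [d₁ p hpU, hv₁, e₁]; simp)
  have hdγ : ∀ q v, dProj (m := 5) (n := 2) π q (γ q v) = 0 := fun q v => hγv q v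
  have hfr : ∀ q ∈ V, IsHorizontalFrameAt π γ q (dAt y₀ (π q)) (dAt y₁ (π q))
      (Z₀ q - γ q (Z₀ q)) (Z₁ q - γ q (Z₁ q)) := by
    intro q hq
    have z := hZ q hq
    rw [d₀ q (hVU hq), d₀ q (hVU hq), d₁ q (hVU hq), d₁ q (hVU hq)] at z
    refine ⟨hγv q, hγs q, ?_, ?_, ?_, ?_, ?_, ?_⟩
    · rw [map_sub, hγs q _ (hγv q _), sub_self]
    · rw [map_sub, hγs q _ (hγv q _), sub_self]
    all_goals rw [map_sub, hdγ, sub_zero]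
    exacts [z.1, z.2.1, z.2.2.1, z.2.2.2]
  refine ⟨y₀, y₁, fun q => Z₀ q - γ q (Z₀ q), fun q => Z₁ q - γ q (Z₁ q), U, V,
    ⟨hU, hV, hVU, hy₀, hy₁, hZ₀.sub (hγ V hV (subset_univ _) _ hZ₀),
      hZ₁.sub (hγ V hV (subset_univ _) _ hZ₁), hfr, ?_⟩, hpV⟩
  -- Smoothness of `ωB` is tested on fields of the base, hence the dual frame `E₀, E₁` there; `dπ
  -- Xᵢ` equals `Eᵢ ∘ π` because both are dual to the `dyᵢ`.
  have hω : SmoothFunOn 2 (fun c => ωB c ![E₀ c, E₁ c]) U := by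
    refine (h.smooth_area U hU (subset_univ _) ![E₀, E₁] ?_).congr fun c _ => ?_
    · intro i
      fin_cases i
      exacts [hE₀, hE₁]
    · congr 1
      ext1 i
      fin_cases i <;> rfl
  refine (hω.comp_proj hπ hVU).congr fun q hq => ?_
  have hEq := hE _ (hVU hq)
  have f := hfr q hq
  have c₀ := f.base_eq (E₀ (π q))
  have c₁ := f.base_eq (E₁ (π q))
  rw [hEq.1, hEq.2.2.1, one_smul, zero_smul, add_zero] at c₀
  rw [hEq.2.1, hEq.2.2.2, one_smul, zero_smul, zero_add] at c₁
  rw [← c₀, ← c₁]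

theorem IsAdaptedFrameOn.isSplitOn {y₀ y₁ : B → ℝ} {X₀ X₁ : ∀ p : M, Tan 5 p} {U : Set B}
    {V : Set M} (hF : IsAdaptedFrameOn π ωB γ y₀ y₁ X₀ X₁ U V)
    (h : IsFiberedTriple π Ω ωB γ κ β) :
    IsSplitOn (tripleBivector π Ω ωB γ κ β) (vertBivector π Ω ωB γ β)
      (fun q => κ q * (ωB (π q)
        ![dProj (m := 5) (n := 2) π q (X₀ q), dProj (m := 5) (n := 2) π q (X₁ q)])⁻¹)
      (fun q => y₀ (π q)) (fun q => y₁ (π q)) X₀ X₁ V := by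
  have hπ := h.submersion.contMDiff
  have d₀ : ∀ q ∈ V, dAt (n := 5) (fun q => y₀ (π q)) q = _ := fun q hq =>
    dAt_comp_proj hF.isOpen_base hF.smooth_fst hπ (hF.mapsTo hq)
  have d₁ : ∀ q ∈ V, dAt (n := 5) (fun q => y₁ (π q)) q = _ := fun q hq =>
    dAt_comp_proj hF.isOpen_base hF.smooth_snd hπ (hF.mapsTo hq)
  refine ⟨hF.isOpen, (h.smooth_kappa.mono (subset_univ _)).mul (hF.smooth_area.inv fun q hq =>
    (hF.frame q hq).area_ne_zero (h.area_ne_zero _)), hF.smooth_fst.comp_proj hπ hF.mapsTo,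
    hF.smooth_snd.comp_proj hπ hF.mapsTo, hF.smooth_vec_fst, hF.smooth_vec_snd,
    fun q hq => ?_, fun q hq => ?_, fun q hq => ?_, fun q hq => ?_, fun q hq α => ?_,
    fun q hq α => ?_, fun q hq α α' => ?_⟩
  · rw [d₀ q hq]; exact (hF.frame q hq).fst_fst
  · rw [d₀ q hq]; exact (hF.frame q hq).fst_snd
  · rw [d₁ q hq]; exact (hF.frame q hq).snd_fst
  · rw [d₁ q hq]; exact (hF.frame q hq).snd_snd
  · rw [d₀ q hq]
    exact (hF.frame q hq).vertBivector_eq_zero (IsHorizontalFrameAt.comp_dProj_mem _) α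
  · rw [d₁ q hq]
    exact (hF.frame q hq).vertBivector_eq_zero (IsHorizontalFrameAt.comp_dProj_mem _) α
  · exact (hF.frame q hq).tripleBivector_apply (h.area_ne_zero _) α α'

end AdaptedFrame

/-! ### From the split form to the global statements -/

section MainResults

variable {M B : Type*}
  [TopologicalSpace M] [ChartedSpace (EuclideanSpace ℝ (Fin 5)) M] [IsManifold (𝓡 5) ∞ M]
  [TopologicalSpace B] [ChartedSpace (EuclideanSpace ℝ (Fin 2)) B] [IsManifold (𝓡 2) ∞ B]
  {π : M → B} {Ω : ∀ p : M, Form (Tan 5 p) 5} {ωB : ∀ b : B, Form (Tan 2 b) 2}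
  {γ : ∀ p : M, Tan 5 p →ₗ[ℝ] Tan 5 p} {κ : M → ℝ} {β : ∀ p : M, Dual ℝ (Tan 5 p)}

namespace IsFiberedTriple

theorem exists_frameAt (h : IsFiberedTriple π Ω ωB γ κ β) (p : M) :
    ∃ y₀ y₁ X₀ X₁, IsHorizontalFrameAt π γ p y₀ y₁ X₀ X₁ :=
  let ⟨_, _, _, _, _, _, hF, hp⟩ := h.exists_adaptedFrame p
  ⟨_, _, _, _, hF.frame p hp⟩

/-- The vertical frame defining `P_β` is chosen point by point, without continuity; smoothness is
read off from `Π` minus its horizontal part. -/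
theorem smoothMultiVecOn_vertBivector (h : IsFiberedTriple π Ω ωB γ κ β)
    (hQ : SmoothMultiVecOn (tripleBivector π Ω ωB γ κ β) univ) :
    SmoothMultiVecOn (vertBivector π Ω ωB γ β) univ := by
  refine fun W hW _ f hf => smoothFunOn_of_locally fun p hp => ?_
  obtain ⟨y₀, y₁, X₀, X₁, U, V, hF, hpV⟩ := h.exists_adaptedFrame p
  have hWV := hW.inter hF.isOpen
  have hS := (hF.isSplitOn h).mono hWV inter_subset_right
  refine ⟨_, hWV, ⟨hp, hpV⟩, (hS.smooth_remainder (hQ.mono (subset_univ _))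
    ((hf 0).mono inter_subset_left) ((hf 1).mono inter_subset_left)).congr fun q _ => ?_⟩
  rw [bracket]
  congr 1
  ext1 i
  fin_cases i <;> rfl

theorem isPoissonOn_vertBivector (h : IsFiberedTriple π Ω ωB γ κ β)
    (hQ : IsPoissonOn (tripleBivector π Ω ωB γ κ β) univ) :
    IsPoissonOn (vertBivector π Ω ωB γ β) univ := by
  refine ⟨h.smoothMultiVecOn_vertBivector hQ.1, fun W hW _ f g k hf hg hk p hp => ?_⟩
  obtain ⟨y₀, y₁, X₀, X₁, U, V, hF, hpV⟩ := h.exists_adaptedFrame p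
  have hWV := hW.inter hF.isOpen
  exact ((hF.isSplitOn h).mono hWV inter_subset_right).schouten_remainder
    (hQ.mono (subset_univ _)) (hf.mono inter_subset_left) (hg.mono inter_subset_left)
    (hk.mono inter_subset_left) ⟨hp, hpV⟩

theorem isPoissonConnectionOn (h : IsFiberedTriple π Ω ωB γ κ β)
    (hQ : IsPoissonOn (tripleBivector π Ω ωB γ κ β) univ) :
    IsPoissonConnectionOn (m := 5) (n := 2) π γ (vertBivector π Ω ωB γ β) {p | κ p ≠ 0} := by
  intro W u hW hu N hN hNW f g hf hg p hp
  have hκ : κ p ≠ 0 := (hNW hp).1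
  obtain ⟨y₀, y₁, X₀, X₁, U, V, hF, hpV⟩ := h.exists_adaptedFrame p
  have hNV := hN.inter hF.isOpen
  have hpNV : p ∈ N ∩ V := ⟨hp, hpV⟩
  have hS := (hF.isSplitOn h).mono hNV inter_subset_right
  have hQ' := hQ.mono (subset_univ (N ∩ V))
  have hf' := hf.mono (inter_subset_left : N ∩ V ⊆ N)
  have hg' := hg.mono (inter_subset_left : N ∩ V ⊆ N)
  have hUW := hF.isOpen_base.inter hW
  have hmaps : N ∩ V ⊆ π ⁻¹' (U ∩ W) := fun q hq => ⟨hF.mapsTo hq.2, (hNW hq.1).2⟩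
  have hπ := h.submersion.contMDiff
  -- The components of `hor u` in the frame are `dyᵢ(u) ∘ π`. Being pulled back from the base, they
  -- have differentials killing `𝕍`, so they are Casimirs of `P_β`.
  have s₀ := (hF.smooth_fst.mono inter_subset_left).dAt_apply hUW (hu.mono inter_subset_right)
  have s₁ := (hF.smooth_snd.mono inter_subset_left).dAt_apply hUW (hu.mono inter_subset_right)
  rw [hS.lieDeriv_combination (s₀.comp_proj hπ hmaps) (s₁.comp_proj hπ hmaps) hpNV
    (fun q hq => (hF.frame q hq.2).horLift_apply _) (fun α => ?_) (fun α => ?_) hf' hg']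
  · have ha := mul_ne_zero hκ (inv_ne_zero ((hF.frame p hpV).area_ne_zero (h.area_ne_zero _)))
    have l₀ := hS.mul_lieDeriv_fst hQ' hf' hg' hpNV
    have l₁ := hS.mul_lieDeriv_snd hQ' hf' hg' hpNV
    rw [(mul_eq_zero.1 l₀).resolve_left ha, (mul_eq_zero.1 l₁).resolve_left ha]
    ring
  · rw [dAt_comp_proj hUW s₀ hπ (hmaps hpNV)]
    exact (hF.frame p hpV).vertBivector_eq_zero (IsHorizontalFrameAt.comp_dProj_mem _) α
  · rw [dAt_comp_proj hUW s₁ hπ (hmaps hpNV)]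
    exact (hF.frame p hpV).vertBivector_eq_zero (IsHorizontalFrameAt.comp_dProj_mem _) α

/-- Locally `π^*ωB = w dx₀ ∧ dx₁` with `w` smooth. -/
theorem smoothFormOn_pullForm (h : IsFiberedTriple π Ω ωB γ κ β) :
    SmoothFormOn (fun p => (κ p)⁻¹ • pullForm (m := 5) π ωB p) {p | κ p ≠ 0} := by
  refine fun W hW hWκ X hX => smoothFunOn_of_locally fun p hp => ?_
  obtain ⟨y₀, y₁, X₀, X₁, U, V, hF, hpV⟩ := h.exists_adaptedFrame p
  have hWV := hW.inter hF.isOpen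
  have hπ := h.submersion.contMDiff
  have hm : W ∩ V ⊆ π ⁻¹' U := inter_subset_right.trans hF.mapsTo
  have hx₀ := hF.smooth_fst.comp_proj (m := 5) hπ hm
  have hx₁ := hF.smooth_snd.comp_proj hπ hm
  have hX' := fun i => SmoothVecOn.mono (hX i) (inter_subset_left : W ∩ V ⊆ W)
  have hs := (((hx₀.dAt_apply hWV (hX' 0)).mul (hx₁.dAt_apply hWV (hX' 1))).sub
    ((hx₁.dAt_apply hWV (hX' 0)).mul (hx₀.dAt_apply hWV (hX' 1)))).mul
      (hF.smooth_area.mono (inter_subset_right : W ∩ V ⊆ V))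
  refine ⟨W ∩ V, hWV, ⟨hp, hpV⟩, (((h.smooth_kappa.mono (subset_univ _)).inv
    fun q hq => hWκ hq.1).mul hs).congr fun q hq => ?_⟩
  rw [dAt_comp_proj hF.isOpen_base hF.smooth_fst hπ (hm hq),
    dAt_comp_proj hF.isOpen_base hF.smooth_snd hπ (hm hq)]
  have e : pullForm π ωB q (fun i => X i q) = ωB (π q)
      ![dProj (m := 5) (n := 2) π q (X 0 q), dProj (m := 5) (n := 2) π q (X 1 q)] := by
    rw [pullForm, AlternatingMap.compLinearMap_apply]
    congr 1
    ext1 i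
    fin_cases i <;> rfl
  rw [AlternatingMap.smul_apply, e, (hF.frame q hq.2).area_eq]
  rfl

theorem isCouplingWithDataOn (h : IsFiberedTriple π Ω ωB γ κ β)
    (hQ : SmoothMultiVecOn (tripleBivector π Ω ωB γ κ β) univ) :
    IsCouplingWithDataOn (m := 5) (n := 2) π (tripleBivector π Ω ωB γ κ β) γ
      (fun p => (κ p)⁻¹ • pullForm π ωB p) (vertBivector π Ω ωB γ β) {p | κ p ≠ 0} where
  smooth := hQ.mono (subset_univ _)
  ehresmann :=
    { mem_vert := fun p _ => h.ehresmann.mem_vert p (mem_univ p)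
      eq_self := fun p _ => h.ehresmann.eq_self p (mem_univ p)
      smooth := fun V hV _ => h.ehresmann.smooth V hV (subset_univ _) }
  hor_eq := fun p hp =>
    let ⟨_, _, _, _, hF⟩ := h.exists_frameAt p
    (hF.sharpAnnVert_eq (h.area_ne_zero _) hp).symm
  smooth_form := h.smoothFormOn_pullForm
  form_horizontal := by
    rintro p _ v ⟨i, hi⟩
    have hi' : dProj (m := 5) (n := 2) π p (v i) = 0 := hi
    rw [AlternatingMap.smul_apply, pullForm, AlternatingMap.compLinearMap_apply,
      (ωB (π p)).map_coord_zero i hi', smul_zero]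
  form_eq := fun p hp α hα v =>
    let ⟨_, _, _, _, hF⟩ := h.exists_frameAt p
    hF.coupling_form_eq (h.area_ne_zero _) hp hα v
  vert_eq := fun p _ =>
    let ⟨_, _, _, _, hF⟩ := h.exists_frameAt p
    hF.comp02_eq (h.area_ne_zero _)

/-- The inclusion forces `γ'` to vanish on `ℍ`, and it agrees with `γ` on the complement `𝕍`. -/
theorem eq_of_sharpAnnVert_le (h : IsFiberedTriple π Ω ωB γ κ β)
    {γ' : ∀ p : M, Tan 5 p →ₗ[ℝ] Tan 5 p} {p : M} (hκ : κ p ≠ 0)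
    (hγ' : ∀ v ∈ vert (m := 5) (n := 2) π p, γ' p v = v)
    (hle : sharpAnnVert (m := 5) (n := 2) π (tripleBivector π Ω ωB γ κ β) p ≤ hor γ' p) :
    γ' p = γ p := by
  obtain ⟨_, _, _, _, hF⟩ := h.exists_frameAt p
  rw [hF.sharpAnnVert_eq (h.area_ne_zero _) hκ] at hle
  ext1 v
  have hv : v - γ p v ∈ hor γ p := by
    change γ p _ = 0
    rw [map_sub, hF.eq_self _ (hF.mem_vert v), sub_self]
  have hv' : γ' p (v - γ p v) = 0 := hle hv
  rwa [map_sub, hγ' _ (hF.mem_vert v), sub_eq_zero] at hv'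

theorem vertBivector_dAt_kappa (h : IsFiberedTriple π Ω ωB γ κ β)
    (hQ : IsPoissonOn (tripleBivector π Ω ωB γ κ β) univ) {p : M} (hκ : κ p = 0)
    (α : Dual ℝ (Tan 5 p)) : vertBivector π Ω ωB γ β p ![dAt κ p, α] = 0 := by
  obtain ⟨W, f, hW, hpW, hf, rfl⟩ := exists_dAt_eq p α
  obtain ⟨y₀, y₁, X₀, X₁, U, V, hF, hpV⟩ := h.exists_adaptedFrame p
  have hWV := hW.inter hF.isOpen
  have hpWV : p ∈ W ∩ V := ⟨hpW, hpV⟩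
  have hS := (hF.isSplitOn h).mono hWV inter_subset_right
  have hz := hS.remainder_dAt_coeff (hQ.mono (subset_univ _)) (hf.mono inter_subset_left) hpWV
    (by rw [hκ, zero_mul])
  have hw := (hF.smooth_area.inv fun q hq => (hF.frame q hq).area_ne_zero (h.area_ne_zero _)).mono
    (inter_subset_right : W ∩ V ⊆ V)
  -- For `a = κ w⁻¹` the product rule at a zero of `κ` leaves `da = w⁻¹ dκ`.
  rw [dAt_mul ((h.smooth_kappa.mono (subset_univ (W ∩ V))).mdifferentiableAt hWV hpWV)
    (hw.mdifferentiableAt hWV hpWV), hκ, zero_smul, zero_add, bivector_smul_left] at hz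
  exact (mul_eq_zero.1 hz).resolve_left
    (inv_ne_zero ((hF.frame p hpV).area_ne_zero (h.area_ne_zero _)))

end IsFiberedTriple

end MainResults

end AlmostCoupling

theorem mainTheorem9 {M B : Type*}
    [TopologicalSpace M] [T2Space M] [SecondCountableTopology M]
    [ChartedSpace (EuclideanSpace ℝ (Fin 5)) M] [IsManifold (𝓡 5) ∞ M]
    [TopologicalSpace B] [T2Space B] [SecondCountableTopology B]
    [ChartedSpace (EuclideanSpace ℝ (Fin 2)) B] [IsManifold (𝓡 2) ∞ B]
    (π : M → B)
    (Ω : ∀ p : M, AlmostCoupling.Form (TangentSpace (𝓡 5) p) 5)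
    (ωB : ∀ b : B, AlmostCoupling.Form (TangentSpace (𝓡 2) b) 2)
    (γ : ∀ p : M, TangentSpace (𝓡 5) p →ₗ[ℝ] TangentSpace (𝓡 5) p)
    (κ : M → ℝ)
    (β : ∀ p : M, Module.Dual ℝ (TangentSpace (𝓡 5) p))
    (hdata : AlmostCoupling.IsFiberedTriple π Ω ωB γ κ β)
    (hPoisson : AlmostCoupling.IsPoissonOn
      (AlmostCoupling.tripleBivector π Ω ωB γ κ β) Set.univ) :
    -- the coupling domain is the open set where `κ` does not vanish
    (AlmostCoupling.couplingDomain 2 γ (AlmostCoupling.tripleBivector π Ω ωB γ κ β)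
        = {p | κ p ≠ 0} ∧ IsOpen {p | κ p ≠ 0}) ∧
    -- there `Π` is a coupling Poisson tensor with geometric data `(γ, π^*ωB / κ, P_β)`
    (AlmostCoupling.IsPoissonOn (AlmostCoupling.tripleBivector π Ω ωB γ κ β) {p | κ p ≠ 0} ∧
      AlmostCoupling.IsCouplingWithDataOn (m := 5) (n := 2) π
        (AlmostCoupling.tripleBivector π Ω ωB γ κ β) γ
        (fun p => (κ p)⁻¹ • AlmostCoupling.pullForm π ωB p)
        (AlmostCoupling.vertBivector π Ω ωB γ β) {p | κ p ≠ 0}) ∧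
    -- `γ` is a Poisson connection there
    AlmostCoupling.IsPoissonConnectionOn (m := 5) (n := 2) π γ
      (AlmostCoupling.vertBivector π Ω ωB γ β) {p | κ p ≠ 0} ∧
    -- and the only connection there whose horizontal bundle contains `Π^♯(𝕍°)`
    (∀ γ' : ∀ p : M, TangentSpace (𝓡 5) p →ₗ[ℝ] TangentSpace (𝓡 5) p,
      AlmostCoupling.IsEhresmannOn (m := 5) (n := 2) π γ' {p | κ p ≠ 0} →
      (∀ p, κ p ≠ 0 → AlmostCoupling.sharpAnnVert (m := 5) (n := 2) π
        (AlmostCoupling.tripleBivector π Ω ωB γ κ β) p ≤ AlmostCoupling.hor γ' p) →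
      ∀ p, κ p ≠ 0 → γ' p = γ p) ∧
    -- `P_β` is a vertical Poisson tensor, and equals `Π` in the interior of the zero set of `κ`
    (AlmostCoupling.IsPoissonOn (AlmostCoupling.vertBivector π Ω ωB γ β) Set.univ ∧
      (∀ p, AlmostCoupling.MultiVec.LiesIn (AlmostCoupling.vertBivector π Ω ωB γ β p)
        (AlmostCoupling.vert (m := 5) (n := 2) π p)) ∧
      ∀ p ∈ interior {p | κ p = 0}, AlmostCoupling.tripleBivector π Ω ωB γ κ β p
        = AlmostCoupling.vertBivector π Ω ωB γ β p) ∧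
    -- at the boundary of the zero set of `κ`, `d_{0,1} κ ∧ β = 0`
    (∀ p ∈ frontier {p | κ p = 0},
      AlmostCoupling.covWedge ![AlmostCoupling.d01 γ κ p, β p] = 0) := by
  have hκ : Continuous κ := continuousOn_univ.1 (ContMDiffOn.continuousOn hdata.smooth_kappa)
  have hopen : IsOpen {p | κ p ≠ 0} := isOpen_ne_fun hκ continuous_const
  refine ⟨⟨?_, hopen⟩, ⟨hPoisson.mono (subset_univ _), hdata.isCouplingWithDataOn hPoisson.1⟩,
    hdata.isPoissonConnectionOn hPoisson, fun γ' hγ' hle p hp => ?_,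
    ⟨hdata.isPoissonOn_vertBivector hPoisson, fun p => ?_, fun p hp => ?_⟩, fun p hp => ?_⟩
  · ext p
    obtain ⟨_, _, _, _, hF⟩ := hdata.exists_frameAt p
    exact hF.mem_couplingDomain_iff (hdata.area_ne_zero _)
  · exact hdata.eq_of_sharpAnnVert_le hp (hγ'.eq_self p hp) (hle p hp)
  · obtain ⟨_, _, _, _, hF⟩ := hdata.exists_frameAt p
    exact hF.liesIn_vertBivector
  · have h0 : κ p = 0 := interior_subset (s := {p | κ p = 0}) hp
    rw [AlmostCoupling.tripleBivector, h0, zero_smul, zero_add]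
  -- The zero set is closed, so it contains its boundary; the identity in fact holds at every zero
  -- of `κ`.
  · have h0 : κ p = 0 := (isClosed_eq hκ continuous_const).frontier_subset hp
    obtain ⟨_, _, _, _, hF⟩ := hdata.exists_frameAt p
    exact hF.covWedge_eq_zero (hdata.volume_ne_zero p) (hdata.area_ne_zero _)
      (hdata.beta_vertical p) (hdata.vertBivector_dAt_kappa hPoisson h0)
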